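/- Let $\mathcal{G}=(V,E)$ be a finite simple undirected graph. A \emph{clique} of $\mathcal{G}$ is a maximal set of pairwise adjacent vertices, and $\mathcal{C}$ denotes the set of cliques. $\mathcal{G}$ is \emph{chordal} if every cycle of length at least four has a chord, i.e. an edge joining two nonconsecutive vertices of the cycle. A \emph{junction tree} of $\mathcal{G}$ is a tree $\mathcal{T}$ with vertex set $\mathcal{C}$ such that for all $C_1,C_2\in\mathcal{C}$ every clique on the path in $\mathcal{T}$ between $C_1$ and $C_2$ contains $C_1\cap C_2$. The \emph{separators} of $\mathcal{G}$ are the sets in $\mathcal{S}=\{C_1\cap C_2 : C_1\sim C_2 \text{ in }\mathcal{T}\}$, and $\nu(D)$, for $D\in\mathcal{S}$, is the number of edges $C_1\sim C_2$ of $\mathcal{T}$ with $C_1\cap C_2=D$. For each $v\in V$ let $\mathcal{H}_v$ be a finite-dimensional complex Hilbert space, with a fixed orthonormal basis, and for $A\subseteq V$ put $\mathcal{H}_A=\bigotimes_{v\in A}\mathcal{H}_v$, with $\mathcal{H}_\varnothing=\mathbb{C}$. For a strictly positive density operator $\rho$ on $\mathcal{H}_V$ (that is, $\rho=\rho^*$,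 $\rho\succ0$, $\mathrm{Tr}(\rho)=1$), let $\rho_A=\mathrm{Tr}_{V\setminus A}(\rho)$ be its reduced density operator on $\mathcal{H}_A$, and let $S(\rho)=-\mathrm{Tr}(\rho\log\rho)$ be the von Neumann entropy. For pairwise disjoint $A,B,D\subseteq V$, say that $A$ and $B$ are \emph{quantum conditionally independent given} $D$ if $$I(A:B\,|\,D)_\rho:=S(\rho_{A\cup D})+S(\rho_{B\cup D})-S(\rho_D)-S(\rho_{A\cup B\cup D})=0 .$$ The state $\rho$ is \emph{quantum Markov} on $\mathcal{G}$ if this holds for all pairwise disjoint $A,B,D\subseteq V$ such that $D$ separates $A$ from $B$ in $\mathcal{G}$, i.e. such that every path from a vertex of $A$ to a vertex of $B$ meets $D$. \textbf{Proposition.} Let $\mathcal{G}$ be chordal. Then $\mathcal{G}$ has a junction tree, and, with $\mathcal{S}$ and $\nu$ computed from any junction tree of $\mathcal{G}$, every strictly positive density operator $\rho$ on $\mathcal{H}_V$ satisfies $$S(\rho)\le\sum_{C\in\mathcal{C}}S(\rho_C)-\sum_{D\in\mathcal{S}}\nu(D)\,S(\rho_D),$$ with equality if and only if $\rho$ is quantum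 Markov on $\mathcal{G}$. -/

import Mathlib

open scoped ComplexOrder Kronecker

/-! ### Graphs -/

namespace SimpleGraph

variable {V : Type*}

/-- A graph is chordal if every cycle of length at least four has a chord, that is, an edge of the
graph joining two nonconsecutive vertices of the cycle. -/
def IsChordalGraph (G : SimpleGraph V) : Prop :=
  ∀ (v : V) (c : G.Walk v v), c.IsCycle → 4 ≤ c.length → ∃ e : Sym2 V, c.IsChord e

/-- `D` separates `A` from `B`: every path from a vertex of `A` to a vertex of `B` meets `D`. -/
def Separates (G : SimpleGraph V) (A B D : Finset V) : Prop :=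
  ∀ a ∈ A, ∀ b ∈ B, ∀ p : G.Walk a b, p.IsPath → ∃ v ∈ p.support, v ∈ D

variable [Fintype V] [DecidableEq V]

open Classical in
/-- The set of cliques of `G`, i.e. of the maximal complete sets of vertices. -/
noncomputable def maxCliques (G : SimpleGraph V) : Finset (Finset V) :=
  Finset.univ.filter fun C => Maximal (fun s : Finset V => G.IsClique (s : Set V)) C

variable {G : SimpleGraph V}

/-- A junction tree: a tree whose vertices are the cliques of `G`, such that every clique on the
path between `C₁` and `C₂` contains `C₁ ∩ C₂`. -/
structure IsJunctionTree (T : SimpleGraph G.maxCliques) : Prop where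
  isTree : T.IsTree
  inter_subset : ∀ (C₁ C₂ : G.maxCliques) (p : T.Walk C₁ C₂), p.IsPath →
    ∀ C ∈ p.support, (C₁ : Finset V) ∩ C₂ ⊆ C

/-- The intersection `C₁ ∩ C₂` attached to an edge `C₁ ∼ C₂` of a graph on the cliques. -/
def edgeInter (e : Sym2 G.maxCliques) : Finset V :=
  e.lift ⟨fun C₁ C₂ : G.maxCliques => (C₁ : Finset V) ∩ C₂, fun _ _ => Finset.inter_comm _ _⟩

open Classical in
/-- The set of separators read off from `T`: the intersections of pairs of adjacent cliques. -/
noncomputable def separators (T : SimpleGraph G.maxCliques) : Finset (Finset V) :=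
  T.edgeFinset.image edgeInter

open Classical in
/-- The multiplicity of `D`: the number of edges of `T` whose intersection is `D`. -/
noncomputable def separatorMult (T : SimpleGraph G.maxCliques) (D : Finset V) : ℕ :=
  (T.edgeFinset.filter fun e => edgeInter e = D).card

end SimpleGraph

/-! ### States

Fix finite index sets `ι v`, `v ∈ V`. The Hilbert space of the site `v` is `ℂ^(ι v)`; for
`A ⊆ V` the space `ℋ_A = ⨂_{v ∈ A} ℂ^(ι v)` is `ℂ^(∏_{v ∈ A} ι v)` through its product basis, and
operators on it are square matrices indexed by `∏_{v ∈ A} ι v`. For `A = ∅` this is `ℂ`. -/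

namespace QState

/-- The strictly positive density operators. -/
structure IsPosDensity {n : Type*} [Fintype n] (ρ : Matrix n n ℂ) : Prop where
  posDef : ρ.PosDef
  trace_eq_one : ρ.trace = 1

/-- The von Neumann entropy `S(ρ) = - Tr (ρ log ρ)`, where the matrix logarithm is given by the
functional calculus of Hermitian matrices. The trace is real for Hermitian `ρ`. -/
noncomputable def entropy {n : Type*} [Fintype n] [DecidableEq n] (ρ : Matrix n n ℂ) : ℝ :=
  -(ρ * cfc Real.log ρ).trace.re

/-- The partial trace over the second tensor factor. -/
def partialTrace {m n : Type*} [Fintype n] (ρ : Matrix (m × n) (m × n) ℂ) : Matrix m m ℂ :=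
  Matrix.of fun x y => ∑ z, ρ (x, z) (y, z)

/-- The defining property of the partial trace: `Tr ((M ⊗ I) ρ) = Tr (M Tr₂ ρ)`. -/
theorem trace_kronecker_one_mul {m n : Type*} [Fintype m] [Fintype n] [DecidableEq n]
    (M : Matrix m m ℂ) (ρ : Matrix (m × n) (m × n) ℂ) :
    ((M ⊗ₖ (1 : Matrix n n ℂ)) * ρ).trace = (M * partialTrace ρ).trace := by
  simp only [Matrix.trace, Matrix.diag, Matrix.mul_apply, Fintype.sum_prod_type,
    Matrix.kroneckerMap_apply, partialTrace, Matrix.of_apply, Matrix.one_apply, mul_ite, mul_one,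
    mul_zero, ite_mul, zero_mul, Finset.sum_ite_eq, Finset.mem_univ, if_true, Finset.mul_sum]
  exact Finset.sum_congr rfl fun _ _ => Finset.sum_comm

variable {V : Type*} [Fintype V] [DecidableEq V] {ι : V → Type*} [∀ v, Fintype (ι v)]

/-- The marginal (reduced density operator) `ρ_A = Tr_{V \ A} ρ` on `ℋ_A`, under the identification
`ℋ_V = ℋ_A ⊗ ℋ_{V \ A}`. -/
def marginal (ρ : Matrix (∀ v, ι v) (∀ v, ι v) ℂ) (A : Finset V) :
    Matrix (∀ v : {v // v ∈ A}, ι v) (∀ v : {v // v ∈ A}, ι v) ℂ :=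
  partialTrace (ρ.reindex (Equiv.piEquivPiSubtypeProd (· ∈ A) ι)
    (Equiv.piEquivPiSubtypeProd (· ∈ A) ι))

variable [∀ v, DecidableEq (ι v)]

/-- The quantum conditional mutual information
`I(A : B | D) = S(ρ_{A ∪ D}) + S(ρ_{B ∪ D}) - S(ρ_D) - S(ρ_{A ∪ B ∪ D})`. -/
noncomputable def condMutualInfo (ρ : Matrix (∀ v, ι v) (∀ v, ι v) ℂ) (A B D : Finset V) : ℝ :=
  entropy (marginal ρ (A ∪ D)) + entropy (marginal ρ (B ∪ D)) - entropy (marginal ρ D)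
    - entropy (marginal ρ (A ∪ B ∪ D))

/-- `A` and `B` are quantum conditionally independent given `D` with respect to `ρ`. -/
def CondIndep (ρ : Matrix (∀ v, ι v) (∀ v, ι v) ℂ) (A B D : Finset V) : Prop :=
  condMutualInfo ρ A B D = 0

/-- The (global) quantum Markov property of `ρ` on `G`. -/
def IsQuantumMarkov (G : SimpleGraph V) (ρ : Matrix (∀ v, ι v) (∀ v, ι v) ℂ) : Prop :=
  ∀ A B D : Finset V, Disjoint A B → Disjoint A D → Disjoint B D →
    G.Separates A B D → CondIndep ρ A B D

end QState

/-! The entropy `h A = S(ρ_A)` is a submodular set function; this is strong subadditivity, and the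
only input about quantum states beyond identifying the marginal on all of `V` with `ρ`. The rest is
combinatorics of submodular functions on trees. Remove a leaf clique `L` with neighbour `M` from a
junction tree, and let `Y` be the union of the other cliques. Then `L ∩ Y = L ∩ M`, so submodularity
for `(L, Y)` and induction give the bound. Equality holds exactly when `h` is modular on every pair
`(S, T)` with union `V` such that each clique lies in `S` or in `T`
(`submodular_le_junctionTree_sum`). Such pairs are the maximal separations of the graph, and
modularity passes to smaller pairs with the same intersection, so this condition is the global
Markov property (`isQuantumMarkov_iff`).

Strong subadditivity follows from monotonicity of relative entropy (`relEntropy_le_relEntropy`),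
proved from a variational formula. Existence of a junction tree follows from Dirac's theorem on
simplicial vertices, removing one such vertex at a time (`IsChordalGraph.exists_tree`). -/

namespace QState

open Matrix Filter Topology

/-! ### Monotonicity of relative entropy -/

section RelativeEntropy

variable {n m : Type*} [Fintype n] [DecidableEq n] [Fintype m] [DecidableEq m]

/-- The relative entropy `Tr ρ (log ρ - log σ)`. -/
noncomputable def relEntropy (ρ σ : Matrix n n ℂ) : ℝ :=
  (ρ * cfc Real.log ρ).trace.re - (ρ * cfc Real.log σ).trace.re

/-- A concave quadratic functional of `X` whose maximum is `Tr ρ (L_σ + t R_ρ)⁻¹ ρ`. -/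
noncomputable def quadFunctional (ρ σ : Matrix n n ℂ) (t : ℝ) (X : Matrix n n ℂ) : ℝ :=
  2 * (Xᴴ * ρ).trace.re - (X * Xᴴ * σ).trace.re - t * (Xᴴ * X * ρ).trace.re

theorem exists_spectral_form {A : Matrix n n ℂ} (hA : A.PosDef) :
    ∃ (U : Matrix n n ℂ) (a : n → ℝ), Uᴴ * U = 1 ∧ U * Uᴴ = 1 ∧ (∀ i, 0 < a i) ∧
      A = U * diagonal (fun i => (a i : ℂ)) * Uᴴ ∧
      cfc Real.log A = U * diagonal (fun i => (Real.log (a i) : ℂ)) * Uᴴ := by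
  refine ⟨hA.1.eigenvectorUnitary, hA.1.eigenvalues, ?_, ?_, hA.eigenvalues_pos, ?_, ?_⟩
  · exact Unitary.coe_star_mul_self hA.1.eigenvectorUnitary
  · exact Unitary.coe_mul_star_self hA.1.eigenvectorUnitary
  · conv_lhs => rw [hA.1.spectral_theorem]
    rfl
  · rw [hA.1.cfc_eq]
    rfl

theorem trace_diagonal_mul_mul_diagonal_mul (f r : n → ℝ) (M : Matrix n n ℂ) :
    (diagonal (fun i => (f i : ℂ)) * M * diagonal (fun i => (r i : ℂ)) * Mᴴ).trace =
      ((∑ i, ∑ j, f i * Complex.normSq (M i j) * r j : ℝ) : ℂ) := by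
  push_cast
  simp only [trace, diag, mul_apply (N := Mᴴ), mul_diagonal, diagonal_mul, conjTranspose_apply]
  refine Finset.sum_congr rfl fun i _ => Finset.sum_congr rfl fun j _ => ?_
  rw [← Complex.mul_conj]
  simp only [RCLike.star_def]
  ring

theorem trace_spectral_mul_spectral (U W : Matrix n n ℂ) (f r : n → ℝ) :
    ((U * diagonal (fun i => (r i : ℂ)) * Uᴴ) * (W * diagonal (fun i => (f i : ℂ)) * Wᴴ)).trace =
      ((∑ i, ∑ j, f i * Complex.normSq ((Wᴴ * U) i j) * r j : ℝ) : ℂ) := by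
  rw [← trace_diagonal_mul_mul_diagonal_mul, trace_mul_comm]
  simp only [conjTranspose_mul, conjTranspose_conjTranspose, mul_assoc]
  rw [trace_mul_comm W]
  simp only [mul_assoc]

/-- In eigenbases of `σ` (left) and `ρ` (right) the functional decouples into one scalar quadratic
per matrix entry, which can be maximized by completing the square. -/
theorem quadFunctional_spectral {U W : Matrix n n ℂ} (hU : Uᴴ * U = 1) (hW : Wᴴ * W = 1)
    (r s : n → ℝ) (t : ℝ) (Y : Matrix n n ℂ) :
    quadFunctional (U * diagonal (fun i => (r i : ℂ)) * Uᴴ)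
        (W * diagonal (fun i => (s i : ℂ)) * Wᴴ) t (W * Y * Uᴴ) =
      ∑ i, ∑ j, (2 * ((Wᴴ * U) i j * star (Y i j)).re * r j
        - (s i + t * r j) * Complex.normSq (Y i j)) := by
  have hU' (Z : Matrix n n ℂ) : Uᴴ * (U * Z) = Z := by rw [← mul_assoc, hU, one_mul]
  have hW' (Z : Matrix n n ℂ) : Wᴴ * (W * Z) = Z := by rw [← mul_assoc, hW, one_mul]
  have h1 : ((W * Y * Uᴴ)ᴴ * (U * diagonal (fun i => (r i : ℂ)) * Uᴴ)).trace =
      ∑ i, ∑ j, (Wᴴ * U) i j * star (Y i j) * r j := by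
    have : ((W * Y * Uᴴ)ᴴ * (U * diagonal (fun i => (r i : ℂ)) * Uᴴ)).trace =
        ((Wᴴ * U) * diagonal (fun i => (r i : ℂ)) * Yᴴ).trace := by
      simp only [conjTranspose_mul, conjTranspose_conjTranspose, mul_assoc]
      rw [trace_mul_comm]
      simp only [mul_assoc, hU, mul_one]
      rw [trace_mul_comm]
      simp only [mul_assoc]
    rw [this]
    simp only [trace, diag, mul_apply (N := Yᴴ), mul_diagonal, conjTranspose_apply]
    refine Finset.sum_congr rfl fun i _ => Finset.sum_congr rfl fun j _ => ?_
    ring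
  have h2 : ((W * Y * Uᴴ) * (W * Y * Uᴴ)ᴴ * (W * diagonal (fun i => (s i : ℂ)) * Wᴴ)).trace =
      ((∑ i, ∑ j, s i * Complex.normSq (Y i j) * 1 : ℝ) : ℂ) := by
    rw [← trace_diagonal_mul_mul_diagonal_mul]
    simp only [conjTranspose_mul, conjTranspose_conjTranspose, mul_assoc, hU', hW']
    rw [trace_mul_comm]
    simp only [mul_assoc, hW, mul_one]
    rw [← mul_assoc, trace_mul_comm]
    simp
  have h3 : ((W * Y * Uᴴ)ᴴ * (W * Y * Uᴴ) * (U * diagonal (fun i => (r i : ℂ)) * Uᴴ)).trace =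
      ((∑ i, ∑ j, 1 * Complex.normSq (Y i j) * r j : ℝ) : ℂ) := by
    rw [← trace_diagonal_mul_mul_diagonal_mul]
    simp only [conjTranspose_mul, conjTranspose_conjTranspose, mul_assoc, hU', hW']
    rw [trace_mul_comm]
    simp only [mul_assoc, hU, mul_one]
    rw [trace_mul_comm]
    simp [mul_assoc]
  rw [quadFunctional, h1, h2, h3, Complex.ofReal_re, Complex.ofReal_re]
  simp only [Complex.re_sum, Complex.re_mul_ofReal, Finset.mul_sum, ← Finset.sum_sub_distrib]
  refine Finset.sum_congr rfl fun i _ => Finset.sum_congr rfl fun j _ => ?_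
  ring

theorem two_mul_re_mul_star_sub_le {c : ℝ} (hc : 0 < c) (r : ℝ) (z y : ℂ) :
    2 * (z * star y).re * r - c * Complex.normSq y ≤ Complex.normSq z * r ^ 2 / c := by
  rw [le_div_iff₀ hc]
  simp only [Complex.normSq_apply, RCLike.star_def, Complex.mul_re, Complex.conj_re,
    Complex.conj_im]
  nlinarith [sq_nonneg (z.re * r - c * y.re), sq_nonneg (z.im * r - c * y.im)]

theorem two_mul_re_mul_star_sub_eq {c : ℝ} (hc : 0 < c) (r : ℝ) (z : ℂ) :
    2 * (z * star (z * ((r / c : ℝ) : ℂ))).re * r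
      - c * Complex.normSq (z * ((r / c : ℝ) : ℂ)) = Complex.normSq z * r ^ 2 / c := by
  simp only [Complex.normSq_apply, RCLike.star_def, Complex.mul_re, Complex.conj_re,
    Complex.conj_im, Complex.mul_im, Complex.ofReal_re, Complex.ofReal_im]
  field_simp
  ring

theorem sum_normSq_eq_one {U W : Matrix n n ℂ} (hU : Uᴴ * U = 1) (hW : W * Wᴴ = 1) (j : n) :
    ∑ i, Complex.normSq ((Wᴴ * U) i j) = 1 := by
  have h : ((Wᴴ * U)ᴴ * (Wᴴ * U)) j j = 1 := by
    have : (Wᴴ * U)ᴴ * (Wᴴ * U) = 1 := by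
      rw [conjTranspose_mul, conjTranspose_conjTranspose, mul_assoc, ← mul_assoc W, hW, one_mul, hU]
    rw [this, one_apply_eq]
  rw [mul_apply] at h
  have h' : ((∑ i, Complex.normSq ((Wᴴ * U) i j) : ℝ) : ℂ) = 1 := by
    rw [← h]
    push_cast
    refine Finset.sum_congr rfl fun i _ => ?_
    rw [conjTranspose_apply, ← Complex.mul_conj, mul_comm]
    rfl
  exact_mod_cast h'

theorem tendsto_log_add_mul_sub_log {r s : ℝ} (hr : 0 < r) :
    Tendsto (fun T : ℝ => Real.log (s + T * r) - Real.log T) atTop (𝓝 (Real.log r)) := by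
  have h1 : Tendsto (fun T : ℝ => s / T + r) atTop (𝓝 r) := by
    simpa using (tendsto_const_nhds.div_atTop tendsto_id).add_const r
  refine ((Real.continuousAt_log hr.ne').tendsto.comp h1).congr' ?_
  filter_upwards [eventually_gt_atTop 0, h1.eventually (lt_mem_nhds hr)] with T hT hpos
  have : s + T * r = T * (s / T + r) := by field_simp
  rw [this, Real.log_mul hT.ne' hpos.ne', Function.comp_apply]
  ring

/-- Here `q t` is the maximum of the quadratic functional and `Φ` its antiderivative. Since `q`
decays like `Tr ρ / t`, subtracting `Tr ρ · log T` leaves a finite limit, the relative entropy.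
Comparing two relative entropies thus reduces to comparing maxima for each `t`. -/
theorem exists_integrated_form {ρ σ : Matrix n n ℂ} (hρ : ρ.PosDef) (hσ : σ.PosDef) :
    ∃ Φ q : ℝ → ℝ, Φ 0 = 0 ∧ (∀ t, 0 ≤ t → HasDerivAt Φ (q t) t) ∧
      (∀ t, 0 ≤ t → IsGreatest (Set.range (quadFunctional ρ σ t)) (q t)) ∧
      Tendsto (fun T => Φ T - ρ.trace.re * Real.log T) atTop (𝓝 (relEntropy ρ σ)) := by
  obtain ⟨U, r, hU, hU', hr, hρe, hρl⟩ := exists_spectral_form hρ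
  obtain ⟨W, s, hW, hW', hs, hσe, hσl⟩ := exists_spectral_form hσ
  set M := Wᴴ * U with hM
  have hpos (t : ℝ) (ht : 0 ≤ t) (i j : n) : 0 < s i + t * r j :=
    add_pos_of_pos_of_nonneg (hs i) (mul_nonneg ht (hr j).le)
  refine ⟨fun T => ∑ i, ∑ j, Complex.normSq (M i j) * r j *
      (Real.log (s i + T * r j) - Real.log (s i)),
    fun t => ∑ i, ∑ j, Complex.normSq (M i j) * r j ^ 2 / (s i + t * r j), ?_, ?_, ?_, ?_⟩
  · simp
  · intro t ht
    refine HasDerivAt.fun_sum fun i _ => HasDerivAt.fun_sum fun j _ => ?_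
    have h := (((hasDerivAt_id t).mul_const (r j)).const_add (s i)).log (hpos t ht i j).ne'
    refine ((h.sub_const (Real.log (s i))).const_mul (Complex.normSq (M i j) * r j)).congr_deriv ?_
    simp only [id]
    ring
  · intro t ht
    constructor
    -- The maximizer solves `σ X + t X ρ = ρ`, an equation diagonal in the two eigenbases.
    · refine ⟨W * (Matrix.of fun i j => M i j * ((r j / (s i + t * r j) : ℝ) : ℂ)) * Uᴴ, ?_⟩
      rw [hρe, hσe, quadFunctional_spectral hU hW]
      exact Finset.sum_congr rfl fun i _ => Finset.sum_congr rfl fun j _ =>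
        two_mul_re_mul_star_sub_eq (hpos t ht i j) (r j) (M i j)
    · rintro _ ⟨X, rfl⟩
      have hX : X = W * (Wᴴ * X * U) * Uᴴ := by
        simp only [mul_assoc, hU', mul_one]
        rw [← mul_assoc, hW', one_mul]
      rw [hX, hρe, hσe, quadFunctional_spectral hU hW]
      exact Finset.sum_le_sum fun i _ => Finset.sum_le_sum fun j _ =>
        two_mul_re_mul_star_sub_le (hpos t ht i j) (r j) (M i j) _
  · have htr : ρ.trace.re = ∑ i, ∑ j, Complex.normSq (M i j) * r j := by
      rw [Finset.sum_comm]
      simp only [← Finset.sum_mul, hM, sum_normSq_eq_one hU hW', one_mul]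
      rw [hρe, trace_mul_comm, ← mul_assoc, hU, one_mul, trace_diagonal]
      simp
    have h1 : (ρ * cfc Real.log ρ).trace.re =
        ∑ i, ∑ j, Complex.normSq (M i j) * r j * Real.log (r j) := by
      rw [Finset.sum_comm]
      simp only [← Finset.sum_mul, hM, sum_normSq_eq_one hU hW', one_mul]
      rw [hρl]
      nth_rewrite 1 [hρe]
      rw [trace_spectral_mul_spectral, hU, Complex.ofReal_re]
      simp [one_apply, apply_ite, Finset.sum_ite_eq, mul_comm]
    have h2 : (ρ * cfc Real.log σ).trace.re =
        ∑ i, ∑ j, Complex.normSq (M i j) * r j * Real.log (s i) := by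
      rw [hσl, hρe, trace_spectral_mul_spectral, Complex.ofReal_re]
      refine Finset.sum_congr rfl fun i _ => Finset.sum_congr rfl fun j _ => ?_
      ring
    rw [relEntropy, h1, h2, htr]
    simp only [Finset.sum_mul, ← Finset.sum_sub_distrib]
    refine tendsto_finsetSum _ fun i _ => tendsto_finsetSum _ fun j _ => ?_
    have h := ((tendsto_log_add_mul_sub_log (s := s i) (hr j)).sub_const
      (Real.log (s i))).const_mul (Complex.normSq (M i j) * r j)
    refine (h.congr fun T => ?_).trans (le_of_eq ?_)
    · ring
    · congr 1
      ring

/-- Monotonicity of the relative entropy under the adjoint of a multiplicative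
`*`-preserving map. -/
theorem relEntropy_le_relEntropy {ρ σ : Matrix n n ℂ} {ρ' σ' : Matrix m m ℂ}
    (hρ : ρ.PosDef) (hσ : σ.PosDef) (hρ' : ρ'.PosDef) (hσ' : σ'.PosDef)
    (ψ : Matrix m m ℂ → Matrix n n ℂ) (hψ1 : ψ 1 = 1) (hψm : ∀ X Y, ψ (X * Y) = ψ X * ψ Y)
    (hψs : ∀ X, ψ Xᴴ = (ψ X)ᴴ) (hψρ : ∀ X, (ψ X * ρ).trace = (X * ρ').trace)
    (hψσ : ∀ X, (ψ X * σ).trace = (X * σ').trace) :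
    relEntropy ρ' σ' ≤ relEntropy ρ σ := by
  obtain ⟨Φ, q, hΦ0, hΦ, hq, hlim⟩ := exists_integrated_form hρ hσ
  obtain ⟨Φ', q', hΦ0', hΦ', hq', hlim'⟩ := exists_integrated_form hρ' hσ'
  -- Equal traces make the two `log T` counterterms cancel.
  have htr : ρ.trace = ρ'.trace := by simpa [hψ1] using hψρ 1
  have hle (t : ℝ) (ht : 0 ≤ t) : q' t ≤ q t := by
    obtain ⟨X, hX⟩ := (hq' t ht).1
    rw [← hX]
    -- `ψ X` is a trial matrix for `(ρ, σ)` with the same value that `X` has for `(ρ', σ')`.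
    refine le_of_eq_of_le ?_ ((hq t ht).2 ⟨ψ X, rfl⟩)
    rw [quadFunctional, quadFunctional, ← hψs, ← hψm, ← hψm, hψρ, hψρ, hψσ]
  have hmono : MonotoneOn (fun t => Φ t - Φ' t) (Set.Ici 0) := by
    refine monotoneOn_of_hasDerivWithinAt_nonneg (convex_Ici 0)
      (f' := fun t => q t - q' t) ?_ ?_ ?_
    · exact fun t ht => ((hΦ t ht).sub (hΦ' t ht)).continuousAt.continuousWithinAt
    · intro t ht
      rw [interior_Ici] at ht
      exact ((hΦ t ht.le).sub (hΦ' t ht.le)).hasDerivWithinAt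
    · intro t ht
      rw [interior_Ici] at ht
      exact sub_nonneg.2 (hle t ht.le)
  refine le_of_tendsto_of_tendsto hlim' hlim ?_
  filter_upwards [eventually_ge_atTop 0] with T hT
  have := hmono Set.self_mem_Ici hT hT
  simp only [hΦ0, hΦ0', sub_zero, sub_nonneg] at this
  rw [htr]
  linarith

end RelativeEntropy

end QState

namespace QState

open Matrix

/-! ### Entropy under `*`-homomorphisms and partial traces -/

section StarHom

variable {n m : Type*} [Fintype n] [DecidableEq n] [Fintype m] [DecidableEq m]

theorem cfc_log_starAlgHom (φ : Matrix m m ℂ →⋆ₐ[ℂ] Matrix n n ℂ) {A : Matrix m m ℂ}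
    (hA : A.IsHermitian) : cfc Real.log (φ A) = φ (cfc Real.log A) := by
  have hA' : IsSelfAdjoint A := hA
  have hc : Continuous φ := φ.toAlgHom.toLinearMap.continuous_of_finiteDimensional
  refine (StarAlgHom.map_cfc (R := ℝ) (S := ℂ) φ Real.log A ?_ hc hA' (hA'.map φ)).symm
  -- The spectrum is finite, so every function is continuous on it and positivity of `A` is not
  -- needed.
  rw [hA.spectrum_real_eq_range_eigenvalues]
  exact (Set.finite_range _).continuousOn _

/-- Renaming the basis as a `*`-homomorphism. -/
def reindexStarHom (e : n ≃ m) : Matrix m m ℂ →⋆ₐ[ℂ] Matrix n n ℂ :=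
  { (Matrix.reindexAlgEquiv ℂ ℂ e.symm : Matrix m m ℂ ≃ₐ[ℂ] Matrix n n ℂ).toAlgHom with
    map_star' := fun _ => rfl }

theorem entropy_submatrix (e : n ≃ m) {A : Matrix m m ℂ} (hA : A.IsHermitian) :
    entropy (A.submatrix e e) = entropy A := by
  have h : cfc Real.log (A.submatrix e e) = (cfc Real.log A).submatrix e e :=
    cfc_log_starAlgHom (reindexStarHom e) hA
  rw [entropy, entropy, h, submatrix_mul_equiv]
  congr 2
  exact Equiv.sum_comp e fun i => (A * cfc Real.log A) i i

/-- `Y ↦ Y ⊗ 1` as a `*`-homomorphism. -/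
def kroneckerOneStarHom (n m : Type*) [Fintype n] [DecidableEq n] [Fintype m] [DecidableEq m] :
    Matrix m m ℂ →⋆ₐ[ℂ] Matrix (m × n) (m × n) ℂ where
  toFun Y := Y ⊗ₖ (1 : Matrix n n ℂ)
  map_one' := one_kronecker_one
  map_mul' X Y := by rw [← mul_kronecker_mul, one_mul]
  map_zero' := zero_kronecker _
  map_add' X Y := add_kronecker _ _ _
  commutes' r := by
    rw [Algebra.algebraMap_eq_smul_one, smul_kronecker, one_kronecker_one,
      Algebra.algebraMap_eq_smul_one]
  map_star' X := by
    simp [star_eq_conjTranspose, conjTranspose_kronecker]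

theorem trace_mul_log_kronecker_one {ρ : Matrix (m × n) (m × n) ℂ}
    (h : (partialTrace ρ).IsHermitian) :
    (ρ * cfc Real.log (partialTrace ρ ⊗ₖ (1 : Matrix n n ℂ))).trace =
      (partialTrace ρ * cfc Real.log (partialTrace ρ)).trace := by
  have := cfc_log_starAlgHom (kroneckerOneStarHom n m) h
  rw [show partialTrace ρ ⊗ₖ (1 : Matrix n n ℂ) = kroneckerOneStarHom n m (partialTrace ρ) from rfl,
    this, trace_mul_comm, trace_mul_comm (partialTrace ρ)]
  exact trace_kronecker_one_mul _ _

/-- This turns monotonicity of relative entropy into an inequality between entropy differences. The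
second argument is not normalized, which monotonicity does not require. -/
theorem relEntropy_partialTrace_kronecker_one {ρ : Matrix (m × n) (m × n) ℂ}
    (h : (partialTrace ρ).IsHermitian) :
    relEntropy ρ (partialTrace ρ ⊗ₖ (1 : Matrix n n ℂ)) = entropy (partialTrace ρ) - entropy ρ := by
  rw [relEntropy, trace_mul_log_kronecker_one h, entropy, entropy]
  ring

theorem posDef_partialTrace {m n : Type*} [Fintype n] [Nonempty n] {ρ : Matrix (m × n) (m × n) ℂ} (hρ : ρ.PosDef) :
    (partialTrace ρ).PosDef := by
  have h : partialTrace ρ = ∑ z, ρ.submatrix (fun x => (x, z)) (fun x => (x, z)) := by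
    ext x y
    simp [partialTrace, Matrix.sum_apply]
  rw [h]
  exact posDef_sum Finset.univ_nonempty fun z _ => hρ.submatrix fun x y hxy => congrArg Prod.fst hxy

end StarHom

/-! ### Strong subadditivity -/

section StrongSubadditivity

variable {a b d : Type*} [Fintype a]

/-- The partial trace over the first of three tensor factors. -/
def partialTraceFirst (ρ : Matrix ((a × d) × b) ((a × d) × b) ℂ) : Matrix (d × b) (d × b) ℂ :=
  Matrix.of fun x y => ∑ z, ρ ((z, x.1), x.2) ((z, y.1), y.2)

theorem partialTraceFirst_eq (ρ : Matrix ((a × d) × b) ((a × d) × b) ℂ) :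
    partialTraceFirst ρ = partialTrace (ρ.submatrix
      (((Equiv.prodComm _ _).trans (Equiv.prodAssoc a d b).symm))
      (((Equiv.prodComm _ _).trans (Equiv.prodAssoc a d b).symm))) := rfl

variable [DecidableEq a] [Fintype b] [DecidableEq b] [Fintype d] [DecidableEq d]

/-- Strong subadditivity of the von Neumann entropy. -/
theorem strong_subadditivity [Nonempty a] [Nonempty b]
    {ρ : Matrix ((a × d) × b) ((a × d) × b) ℂ} (hρ : ρ.PosDef) :
    entropy (partialTrace (partialTraceFirst ρ)) + entropy ρ ≤
      entropy (partialTrace ρ) + entropy (partialTraceFirst ρ) := by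
  have hAD := posDef_partialTrace hρ
  have hDB : (partialTraceFirst ρ).PosDef := by
    rw [partialTraceFirst_eq]
    exact posDef_partialTrace (hρ.submatrix (Equiv.injective _))
  have hD := posDef_partialTrace hDB
  -- Monotonicity for `Y ↦ 1 ⊗ Y`, whose adjoint discards the first factor, reads `S(D) - S(DB) ≤
  -- S(AD) - S(ADB)`.
  have key := relEntropy_le_relEntropy (ρ := ρ) (σ := partialTrace ρ ⊗ₖ (1 : Matrix b b ℂ))
    (ρ' := partialTraceFirst ρ)
    (σ' := partialTrace (partialTraceFirst ρ) ⊗ₖ (1 : Matrix b b ℂ))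
    hρ (hAD.kronecker PosDef.one) hDB (hD.kronecker PosDef.one)
    (fun Y => ((1 : Matrix a a ℂ) ⊗ₖ Y).submatrix (Equiv.prodAssoc a d b) (Equiv.prodAssoc a d b))
    (by rw [one_kronecker_one, submatrix_one_equiv])
    (fun X Y => by rw [submatrix_mul_equiv, ← mul_kronecker_mul, one_mul])
    (fun X => by rw [conjTranspose_submatrix, conjTranspose_kronecker, conjTranspose_one])
    (fun X => by
      simp only [trace, diag, mul_apply, Fintype.sum_prod_type, submatrix_apply,
        Equiv.prodAssoc_apply, kroneckerMap_apply, one_apply, ite_mul, one_mul, zero_mul,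
        partialTraceFirst, of_apply, Finset.mul_sum, Finset.sum_ite_irrel, Finset.sum_const_zero,
        Finset.sum_ite_eq, Finset.mem_univ, if_true]
      rw [Finset.sum_comm]
      refine Finset.sum_congr rfl fun _ _ => ?_
      rw [Finset.sum_comm]
      refine Finset.sum_congr rfl fun _ _ => ?_
      rw [Finset.sum_comm]
      refine Finset.sum_congr rfl fun _ _ => ?_
      rw [Finset.sum_comm])
    (fun X => by
      simp only [trace, diag, mul_apply, Fintype.sum_prod_type, submatrix_apply,
        Equiv.prodAssoc_apply, kroneckerMap_apply, one_apply, ite_mul, one_mul, zero_mul,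
        partialTraceFirst, partialTrace, of_apply, Finset.mul_sum, Finset.sum_ite_irrel,
        Finset.sum_const_zero, Finset.sum_ite_eq, Finset.sum_ite_eq', Finset.mem_univ, if_true,
        mul_ite, mul_one, mul_zero]
      rw [Finset.sum_comm]
      refine Finset.sum_congr rfl fun _ _ => ?_
      rw [Finset.sum_comm]
      refine Finset.sum_congr rfl fun _ _ => ?_
      rw [Finset.sum_comm]
      refine Finset.sum_congr rfl fun _ _ => ?_
      rw [Finset.sum_comm])
  rw [relEntropy_partialTrace_kronecker_one hAD.1, relEntropy_partialTrace_kronecker_one hD.1] at key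
  linarith

end StrongSubadditivity

/-! ### Marginals and submodularity of their entropy -/

section Marginal

variable {V : Type*} {ι : V → Type*}

/-- Gluing configurations on disjoint sets of sites. -/
def glue {p q r : V → Prop} [DecidablePred p] (h : ∀ v, r v ↔ p v ∨ q v)
    (hd : ∀ v, p v → ¬ q v) :
    (∀ v : {v // p v}, ι v) × (∀ v : {v // q v}, ι v) ≃ ∀ v : {v // r v}, ι v where
  toFun x v := if hv : p v then x.1 ⟨v, hv⟩ else x.2 ⟨v, ((h v).1 v.2).resolve_left hv⟩
  invFun x := (fun v => x ⟨v, (h v).2 (Or.inl v.2)⟩, fun v => x ⟨v, (h v).2 (Or.inr v.2)⟩)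
  left_inv x := by
    ext v
    · simp [v.2]
    · have : ¬ p v := fun hp => hd v hp v.2
      simp [this]
  right_inv x := by
    ext v
    by_cases hv : p v <;> simp [hv]

variable [Fintype V] [DecidableEq V] [∀ v, Fintype (ι v)]

theorem marginal_eq_partialTrace (ρ : Matrix (∀ v, ι v) (∀ v, ι v) ℂ) {A B Z : Finset V}
    (h : ∀ v, v ∈ Z ↔ v ∈ A ∨ v ∈ B) (hd : ∀ v, v ∈ A → ¬ v ∈ B) :
    marginal ρ A =
      partialTrace ((marginal ρ Z).submatrix (glue (ι := ι) h hd) (glue (ι := ι) h hd)) := by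
  -- The complement of `A` splits into `B` and the complement of `Z`, so tracing it out is tracing
  -- out `Zᶜ` and then `B`.
  have h' (v : V) : v ∉ A ↔ v ∈ B ∨ v ∉ Z := by
    have := h v
    have := hd v
    tauto
  have hd' (v : V) (hv : v ∈ B) : ¬ v ∉ Z := fun hn => hn ((h v).2 (Or.inr hv))
  have hg (x : ∀ v : {v // v ∈ A}, ι v) (z : ∀ v : {v // v ∈ B}, ι v)
      (u : ∀ v : {v // v ∉ Z}, ι v) :
      (Equiv.piEquivPiSubtypeProd (· ∈ A) ι).symm (x, glue (ι := ι) h' hd' (z, u)) =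
        (Equiv.piEquivPiSubtypeProd (· ∈ Z) ι).symm (glue (ι := ι) h hd (x, z), u) := by
    ext v
    by_cases hA : v ∈ A
    · have hZ : v ∈ Z := (h v).2 (Or.inl hA)
      simp [Equiv.piEquivPiSubtypeProd, glue, hA, hZ]
    · by_cases hB : v ∈ B
      · have hZ : v ∈ Z := (h v).2 (Or.inr hB)
        simp [Equiv.piEquivPiSubtypeProd, glue, hA, hB, hZ]
      · have hZ : v ∉ Z := fun hZ => ((h v).1 hZ).elim hA hB
        simp [Equiv.piEquivPiSubtypeProd, glue, hA, hB, hZ]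
  ext x y
  simp only [marginal, partialTrace, reindex_apply, submatrix_apply, of_apply]
  rw [← (glue (ι := ι) h' hd').sum_comp, Fintype.sum_prod_type]
  exact Finset.sum_congr rfl fun z _ => Finset.sum_congr rfl fun u _ => by rw [hg, hg]

theorem posDef_marginal [∀ v, Nonempty (ι v)] {ρ : Matrix (∀ v, ι v) (∀ v, ι v) ℂ}
    (hρ : ρ.PosDef) (A : Finset V) : (marginal ρ A).PosDef :=
  posDef_partialTrace (hρ.submatrix (Equiv.injective _))

variable [∀ v, DecidableEq (ι v)]

theorem entropy_marginal_univ {ρ : Matrix (∀ v, ι v) (∀ v, ι v) ℂ} (hρ : ρ.IsHermitian) :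
    entropy (marginal ρ Finset.univ) = entropy ρ := by
  let e : (∀ v : {v // v ∈ (Finset.univ : Finset V)}, ι v) ≃ ∀ v, ι v :=
    { toFun := fun x v => x ⟨v, Finset.mem_univ v⟩
      invFun := fun x v => x v
      left_inv := fun _ => rfl
      right_inv := fun _ => rfl }
  have : IsEmpty {v // ¬ v ∈ (Finset.univ : Finset V)} := ⟨fun v => v.2 (Finset.mem_univ _)⟩
  have h : marginal ρ Finset.univ = ρ.submatrix e e := by
    ext x y
    simp only [marginal, partialTrace, reindex_apply, submatrix_apply, of_apply,
      Finset.univ_unique, Finset.sum_singleton]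
    congr 1 <;> ext v <;> simp [Equiv.piEquivPiSubtypeProd, e]
  rw [h, entropy_submatrix e hρ]

theorem strong_subadditivity_marginal [∀ v, Nonempty (ι v)]
    {ρ : Matrix (∀ v, ι v) (∀ v, ι v) ℂ} (hρ : ρ.PosDef) {A B D : Finset V}
    (hAB : Disjoint A B) (hAD : Disjoint A D) (hBD : Disjoint B D) :
    entropy (marginal ρ D) + entropy (marginal ρ ((A ∪ D) ∪ B)) ≤
      entropy (marginal ρ (A ∪ D)) + entropy (marginal ρ (D ∪ B)) := by
  rw [Finset.disjoint_left] at hAB hAD hBD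
  have h1 (v : V) : v ∈ A ∪ D ↔ v ∈ A ∨ v ∈ D := Finset.mem_union
  have h2 (v : V) : v ∈ (A ∪ D) ∪ B ↔ v ∈ A ∪ D ∨ v ∈ B := Finset.mem_union
  have h3 (v : V) : v ∈ D ∪ B ↔ v ∈ D ∨ v ∈ B := Finset.mem_union
  have h4 (v : V) : v ∈ (A ∪ D) ∪ B ↔ v ∈ D ∪ B ∨ v ∈ A := by
    simp only [Finset.mem_union]
    tauto
  have d1 (v : V) (hv : v ∈ A) : ¬ v ∈ D := hAD hv
  have d2 (v : V) (hv : v ∈ A ∪ D) : ¬ v ∈ B := fun hB =>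
    (Finset.mem_union.1 hv).elim (fun hA => hAB hA hB) (hBD hB)
  have d3 (v : V) (hv : v ∈ D) : ¬ v ∈ B := fun hB => hBD hB hv
  have d4 (v : V) (hv : v ∈ D ∪ B) : ¬ v ∈ A := fun hA =>
    (Finset.mem_union.1 hv).elim (hAD hA) (hAB hA)
  let g1 := glue (ι := ι) h1 d1
  let g2 := glue (ι := ι) h2 d2
  let g3 := glue (ι := ι) h3 d3
  let g4 := glue (ι := ι) h4 d4
  let e := (g1.prodCongr (Equiv.refl _)).trans g2
  -- The bracketings `(A, D), B` and `(D, B), A` glue to the same configuration, so the two partial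
  -- traces of one matrix are the two marginals.
  have hg (x : ∀ v : {v // v ∈ A}, ι v) (y : ∀ v : {v // v ∈ D}, ι v)
      (z : ∀ v : {v // v ∈ B}, ι v) : e ((x, y), z) = g4 (g3 (y, z), x) := by
    ext v
    by_cases hA : v.1 ∈ A
    · have hB := hAB hA
      have hD := hAD hA
      simp [e, g1, g2, g3, g4, glue, hA, hB, hD]
    · by_cases hD : v.1 ∈ D
      · simp [e, g1, g2, g3, g4, glue, hA, hD]
      · have hB : v.1 ∈ B := by
          have := v.2
          simp only [Finset.mem_union] at this
          tauto
        simp [e, g1, g2, g3, g4, glue, hA, hD, hB]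
  have m1 : partialTrace ((marginal ρ ((A ∪ D) ∪ B)).submatrix e e) =
      (marginal ρ (A ∪ D)).submatrix g1 g1 := by
    rw [marginal_eq_partialTrace ρ h2 d2]
    rfl
  have m2 : partialTraceFirst ((marginal ρ ((A ∪ D) ∪ B)).submatrix e e) =
      (marginal ρ (D ∪ B)).submatrix g3 g3 := by
    rw [marginal_eq_partialTrace ρ h4 d4]
    ext x y
    simp only [partialTraceFirst, partialTrace, of_apply, submatrix_apply, hg]
    rfl
  have key := strong_subadditivity ((posDef_marginal hρ ((A ∪ D) ∪ B)).submatrix e.injective)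
  rwa [m1, m2, ← marginal_eq_partialTrace ρ h3 d3,
    entropy_submatrix _ (posDef_marginal hρ _).1, entropy_submatrix _ (posDef_marginal hρ _).1,
    entropy_submatrix _ (posDef_marginal hρ _).1] at key

/-- The entropy of the marginals is a submodular set function. -/
theorem entropy_marginal_submodular [∀ v, Nonempty (ι v)]
    {ρ : Matrix (∀ v, ι v) (∀ v, ι v) ℂ} (hρ : ρ.PosDef) (S T : Finset V) :
    entropy (marginal ρ (S ∩ T)) + entropy (marginal ρ (S ∪ T)) ≤
      entropy (marginal ρ S) + entropy (marginal ρ T) := by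
  have h := strong_subadditivity_marginal hρ (A := S \ T) (B := T \ S) (D := S ∩ T)
    (disjoint_sdiff_sdiff) (Finset.disjoint_left.2 (by simp; tauto))
    (Finset.disjoint_left.2 (by simp; tauto))
  have e1 : S \ T ∪ S ∩ T = S := Finset.sdiff_union_inter S T
  have e2 : S ∩ T ∪ T \ S = T := by
    ext v
    simp only [Finset.mem_union, Finset.mem_inter, Finset.mem_sdiff]
    tauto
  have e3 : S ∪ T \ S = S ∪ T := Finset.union_sdiff_self_eq_union
  rwa [e1, e2, e3] at h

end Marginal

end QState

namespace SimpleGraph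

/-! ### Equality in submodularity -/

section Submodular

variable {V : Type*} [DecidableEq V] {h : Finset V → ℝ}

/-- For entropies: conditional mutual information given a fixed `D` decreases when its two arguments
shrink, so it stays zero. Shrink `T` to `T₁` first, then `S` to `S₁`. -/
theorem modular_of_subset (hsub : ∀ S T, h (S ∩ T) + h (S ∪ T) ≤ h S + h T)
    {S T S₁ T₁ : Finset V} (hS : S₁ ⊆ S) (hT : T₁ ⊆ T) (hST : S₁ ∩ T₁ = S ∩ T)
    (hm : h S + h T = h (S ∩ T) + h (S ∪ T)) :
    h S₁ + h T₁ = h (S₁ ∩ T₁) + h (S₁ ∪ T₁) := by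
  have h1 := hsub (S ∪ T₁) T
  have h2 := hsub (S₁ ∪ T₁) S
  have h3 := hsub S₁ T₁
  have hmem (v : V) := Finset.ext_iff.1 hST v
  simp only [Finset.mem_inter] at hmem
  have e1 : (S ∪ T₁) ∩ T = T₁ := by ext v; clear h1 h2 h3; grind
  have e2 : (S ∪ T₁) ∪ T = S ∪ T := by ext v; clear h1 h2 h3; grind
  have e3 : (S₁ ∪ T₁) ∩ S = S₁ := by ext v; clear h1 h2 h3; grind
  have e4 : (S₁ ∪ T₁) ∪ S = S ∪ T₁ := by ext v; clear h1 h2 h3; grind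
  rw [e1, e2] at h1
  rw [e3, e4] at h2
  rw [hST] at h3 ⊢
  linarith

/-- Modularity on `(L, Y)` and on the traces of `S`, `T` on `Y` combine to modularity on `(S, T)`:
submodularity for `(L, S ∩ Y)` and `(T ∩ Y, S ∩ T)` bounds `h S + h T` from above. -/
theorem modular_of_modular_inter (hsub : ∀ S T, h (S ∩ T) + h (S ∪ T) ≤ h S + h T)
    {L Y S T : Finset V} (hLS : L ⊆ S) (hST : S ∪ T = L ∪ Y)
    (hLY : h L + h Y = h (L ∩ Y) + h (L ∪ Y))
    (hY : h (S ∩ Y) + h (T ∩ Y) = h ((S ∩ Y) ∩ (T ∩ Y)) + h ((S ∩ Y) ∪ (T ∩ Y))) :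
    h S + h T = h (S ∩ T) + h (S ∪ T) := by
  have h1 := hsub L (S ∩ Y)
  have h2 := hsub (T ∩ Y) (S ∩ T)
  have h3 := hsub S T
  have hmem (v : V) := Finset.ext_iff.1 hST v
  simp only [Finset.mem_union] at hmem
  have e1 : L ∩ (S ∩ Y) = L ∩ Y := by ext v; clear hLY hY h1 h2 h3; grind
  have e2 : L ∪ (S ∩ Y) = S := by ext v; clear hLY hY h1 h2 h3; grind
  have e3 : (S ∩ Y) ∩ (T ∩ Y) = (T ∩ Y) ∩ (S ∩ T) := by ext v; clear hLY hY h1 h2 h3; grind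
  have e4 : (S ∩ Y) ∪ (T ∩ Y) = Y := by ext v; clear hLY hY h1 h2 h3; grind
  have e5 : (T ∩ Y) ∪ (S ∩ T) = T := by ext v; clear hLY hY h1 h2 h3; grind
  rw [e1, e2] at h1
  rw [e3, e4] at hY
  rw [e5] at h2
  rw [hST] at h3 ⊢
  linarith

end Submodular

/-! ### The junction tree inequality -/

section JunctionTree

variable {V : Type*} [DecidableEq V]

/-- The intersection of the sets attached to the ends of an edge. -/
def interEdge {I : Type*} (X : I → Finset V) (e : Sym2 I) : Finset V :=
  e.lift ⟨fun i j => X i ∩ X j, fun _ _ => Finset.inter_comm _ _⟩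

theorem IsTree.exists_leaf {I : Type*} [Finite I] [Nontrivial I] {T : SimpleGraph I}
    (hT : T.IsTree) : ∃ l m, T.Adj l m ∧ (∀ k, T.Adj l k → k = m) ∧ (T.induce {l}ᶜ).IsTree := by
  classical
  have := Fintype.ofFinite I
  obtain ⟨l, hl⟩ := hT.exists_vert_degree_one_of_nontrivial
  obtain ⟨m, hm, huniq⟩ := degree_eq_one_iff_existsUnique_adj.1 hl
  exact ⟨l, m, hm, huniq, hT.connected.induce_compl_singleton_of_degree_eq_one hl,
    hT.isAcyclic.induce _⟩

theorem sum_edgeFinset_of_leaf {I : Type*} {T : SimpleGraph I} {l m : I}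
    [Fintype T.edgeSet] [Fintype (T.induce {l}ᶜ).edgeSet]
    (hlm : T.Adj l m) (hl : ∀ k, T.Adj l k → k = m) (f : Sym2 I → ℝ) :
    ∑ e ∈ T.edgeFinset, f e =
      f s(l, m) + ∑ e ∈ (T.induce {l}ᶜ).edgeFinset, f (e.map Subtype.val) := by
  classical
  have h : T.edgeFinset =
      insert s(l, m) ((T.induce {l}ᶜ).edgeFinset.image (Sym2.map Subtype.val)) := by
    ext e
    induction e with
    | _ a b =>
      simp only [mem_edgeFinset, mem_edgeSet, Finset.mem_insert, Finset.mem_image]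
      constructor
      · intro hab
        by_cases ha : a = l
        · subst ha
          rw [hl b hab]
          exact Or.inl rfl
        by_cases hb : b = l
        · subst hb
          rw [hl a hab.symm]
          exact Or.inl Sym2.eq_swap
        · exact Or.inr ⟨s(⟨a, ha⟩, ⟨b, hb⟩), hab, rfl⟩
      · rintro (hab | ⟨e, he, hab⟩)
        · rw [← mem_edgeSet, hab]
          exact hlm
        · induction e with
          | _ c d =>
            rw [← mem_edgeSet, ← hab]
            exact he
  rw [h, Finset.sum_insert, Finset.sum_image]
  · exact fun _ _ _ _ hxy => Sym2.map.injective Subtype.val_injective hxy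
  · rw [Finset.mem_image]
    rintro ⟨e, -, he⟩
    have hmem : l ∈ Sym2.map Subtype.val e := by
      rw [he]
      exact Sym2.mem_mk_left _ _
    obtain ⟨x, -, hx⟩ := Sym2.mem_map.1 hmem
    exact x.2 hx

/-- A submodular set function of a union is at most its junction tree sum, with equality exactly
when the function is modular on all the pairs that split the family. -/
theorem submodular_le_junctionTree_sum {h : Finset V → ℝ}
    (hsub : ∀ S T, h (S ∩ T) + h (S ∪ T) ≤ h S + h T) {I : Type*} [Fintype I]
    {T : SimpleGraph I} [Fintype T.edgeSet] (hT : T.IsTree) (X : I → Finset V)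
    (hX : ∀ (i j : I) (p : T.Walk i j), p.IsPath → ∀ k ∈ p.support, X i ∩ X j ⊆ X k) :
    h (Finset.univ.biUnion X) ≤ ∑ i, h (X i) - ∑ e ∈ T.edgeFinset, h (interEdge X e) ∧
    (h (Finset.univ.biUnion X) = ∑ i, h (X i) - ∑ e ∈ T.edgeFinset, h (interEdge X e) ↔
      ∀ A B, A ∪ B = Finset.univ.biUnion X → (∀ i, X i ⊆ A ∨ X i ⊆ B) →
        h A + h B = h (A ∩ B) + h (A ∪ B)) := by
  classical
  induction hn : Fintype.card I using Nat.strong_induction_on generalizing I with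
  | _ n ih =>
  rcases subsingleton_or_nontrivial I with hI | hI
  · obtain ⟨i⟩ := hT.connected.nonempty
    have hu : (Finset.univ : Finset I) = {i} := Finset.eq_singleton_iff_unique_mem.2
      ⟨Finset.mem_univ _, fun j _ => Subsingleton.elim j i⟩
    have he : T.edgeFinset = ∅ := by
      rw [edgeFinset_eq_empty]
      exact Subsingleton.elim _ _
    rw [he, hu]
    simp only [Finset.singleton_biUnion, Finset.sum_singleton, Finset.sum_empty, sub_zero, le_refl,
      true_and, true_iff]
    intro A B hAB hi
    rcases hi i with hi | hi
    · have hB : B ⊆ A := (hAB ▸ Finset.subset_union_right).trans hi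
      rw [Finset.inter_eq_right.2 hB, Finset.union_eq_left.2 hB, add_comm]
    · have hA : A ⊆ B := (hAB ▸ Finset.subset_union_left).trans hi
      rw [Finset.inter_eq_left.2 hA, Finset.union_eq_right.2 hA]
  -- Induction by deleting a leaf `l` with its only neighbour `m`.
  obtain ⟨l, m, hlm, hl, hT'⟩ := hT.exists_leaf
  set X' : ({l}ᶜ : Set I) → Finset V := fun i => X i with hX'
  have hcard : Fintype.card ({l}ᶜ : Set I) < n := by
    rw [← hn]
    exact Fintype.card_subtype_lt (x := l) (by simp)
  obtain ⟨ih1, ih2⟩ := ih _ hcard hT' X' (fun i j p hp k hk => by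
    let f : T.induce {l}ᶜ →g T := (Embedding.induce _).toHom
    have hk' : f k ∈ (p.map f).support := by
      rw [Walk.support_map]
      exact List.mem_map_of_mem hk
    exact hX _ _ (p.map f) (hp.map Subtype.val_injective) _ hk') rfl
  have hml : m ≠ l := hlm.ne'
  have hrip (i : I) (hi : i ≠ l) : X l ∩ X i ⊆ X m := by
    obtain ⟨p, hp⟩ := hT.connected.exists_isPath l i
    refine hX l i p hp m ?_
    cases p with
    | nil => exact absurd rfl hi
    | cons hadj q =>
      rw [← hl _ hadj]
      simp
  have hsum : ∑ i, h (X i) = h (X l) + ∑ i, h (X' i) := by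
    rw [← Finset.add_sum_erase _ _ (Finset.mem_univ l)]
    congr 1
    exact (Finset.sum_subtype _ (by simp) (fun i => h (X i)))
  have hedge : ∑ e ∈ T.edgeFinset, h (interEdge X e) =
      h (X l ∩ X m) + ∑ e ∈ (T.induce {l}ᶜ).edgeFinset, h (interEdge X' e) := by
    rw [sum_edgeFinset_of_leaf hlm hl]
    congr 1
    refine Finset.sum_congr rfl fun e _ => ?_
    induction e with
    | _ a b => rfl
  set Y := Finset.univ.biUnion X' with hY
  have hmemY (v : V) : v ∈ Y ↔ ∃ i, i ≠ l ∧ v ∈ X i := by simp [hY, hX']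
  have hU : Finset.univ.biUnion X = X l ∪ Y := by
    ext v
    simp only [Finset.mem_biUnion, Finset.mem_univ, true_and, Finset.mem_union, hmemY]
    constructor
    · rintro ⟨i, hi⟩
      by_cases hil : i = l
      · exact Or.inl (hil ▸ hi)
      · exact Or.inr ⟨i, hil, hi⟩
    · rintro (hi | ⟨i, -, hi⟩)
      exacts [⟨l, hi⟩, ⟨i, hi⟩]
  have hXY (i : I) (hi : i ≠ l) : X i ⊆ Y := fun v hv => (hmemY v).2 ⟨i, hi, hv⟩
  -- Every path leaving `l` passes through `m`, so the running intersection property confines the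
  -- overlap to the separator of the deleted edge.
  have hLY : X l ∩ Y = X l ∩ X m := by
    ext v
    simp only [Finset.mem_inter, hmemY]
    constructor
    · rintro ⟨hv, i, hi, hvi⟩
      exact ⟨hv, hrip i hi (Finset.mem_inter.2 ⟨hv, hvi⟩)⟩
    · exact fun ⟨hv, hvm⟩ => ⟨hv, m, hml, hvm⟩
  have hstep := hsub (X l) Y
  rw [hsum, hedge, hU]
  rw [hLY] at hstep
  refine ⟨by linarith, ?_⟩
  constructor
  -- The bound is a sum of two inequalities, so equality forces equality in both.
  · intro heq
    have hm1 : h (X l) + h Y = h (X l ∩ Y) + h (X l ∪ Y) := by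
      rw [hLY]
      linarith
    have hm2 := ih2.1 (by linarith)
    have main (A B : Finset V) (hAB : A ∪ B = X l ∪ Y) (hi : ∀ i, X i ⊆ A ∨ X i ⊆ B)
        (hlA : X l ⊆ A) : h A + h B = h (A ∩ B) + h (A ∪ B) := by
      refine modular_of_modular_inter hsub hlA hAB hm1 (hm2 (A ∩ Y) (B ∩ Y) ?_ fun i => ?_)
      · rw [← Finset.union_inter_distrib_right, hAB]
        exact Finset.inter_eq_right.2 Finset.subset_union_right
      · exact (hi i).imp (fun hA => Finset.subset_inter hA (hXY i i.2))
          fun hB => Finset.subset_inter hB (hXY i i.2)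
    intro A B hAB hi
    rcases hi l with hlA | hlB
    · exact main A B hAB hi hlA
    · rw [add_comm, Finset.inter_comm, Finset.union_comm]
      exact main B A (by rw [Finset.union_comm, hAB]) (fun i => (hi i).symm) hlB
  · intro hM
    have hm1 : h (X l) + h Y = h (X l ∩ Y) + h (X l ∪ Y) := by
      refine hM _ _ rfl fun i => ?_
      by_cases hi : i = l
      · exact Or.inl (hi ▸ subset_rfl)
      · exact Or.inr (hXY i hi)
    -- A split of `Y` extends to the whole family by adding `X l` to the side containing `X m`. As
    -- `X l ∩ Y ⊆ X m`, the intersection of the two sides is unchanged.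
    have main (A B : Finset V) (hAB : A ∪ B = Y) (hi : ∀ i, X' i ⊆ A ∨ X' i ⊆ B)
        (hmA : X m ⊆ A) : h A + h B = h (A ∩ B) + h (A ∪ B) := by
      have hLA : X l ∩ Y ⊆ A := hLY ▸ Finset.inter_subset_right.trans hmA
      refine modular_of_subset hsub (S := A ∪ X l) (T := B) Finset.subset_union_left subset_rfl
        ?_ (hM _ _ ?_ fun i => ?_)
      · rw [Finset.union_inter_distrib_right, eq_comm, Finset.union_eq_left]
        exact fun v hv => Finset.mem_inter.2 ⟨hLA (Finset.mem_inter.2 ⟨(Finset.mem_inter.1 hv).1,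
          hAB ▸ Finset.mem_union_right A (Finset.mem_inter.1 hv).2⟩), (Finset.mem_inter.1 hv).2⟩
      · rw [Finset.union_right_comm, hAB, Finset.union_comm]
      by_cases hil : i = l
      · exact Or.inl (hil ▸ Finset.subset_union_right)
      · exact (hi ⟨i, hil⟩).imp (fun hA => hA.trans Finset.subset_union_left) id
    have hm2 := ih2.2 (fun A B hAB hi => by
      rcases hi ⟨m, hml⟩ with hmA | hmB
      · exact main A B hAB hi hmA
      · rw [add_comm, Finset.inter_comm, Finset.union_comm]
        exact main B A (by rw [Finset.union_comm, hAB]) (fun i => (hi i).symm) hmB)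
    rw [hLY] at hm1
    linarith

end JunctionTree

end SimpleGraph

namespace SimpleGraph

/-! ### Chordal graphs and Dirac's theorem -/

section Chordal

variable {V : Type*} {G : SimpleGraph V}

/-- An edge between two vertices of the walk that the walk does not use is a shortcut. -/
theorem Walk.exists_shorter_of_adj {x y : V} (p : G.Walk x y) {a b : V} (ha : a ∈ p.support)
    (hb : b ∈ p.support) (hab : G.Adj a b) (he : s(a, b) ∉ p.edges) :
    ∃ q : G.Walk x y, q.length < p.length ∧ q.support ⊆ p.support := by
  classical
  induction p with
  | nil =>
    simp only [support_nil, List.mem_singleton] at ha hb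
    exact absurd (ha.trans hb.symm) hab.ne
  | @cons x z y hxz p ih =>
    have key (c : V) (hc : c ∈ p.support) (hxc : G.Adj x c)
        (hn : s(x, c) ∉ (Walk.cons hxz p).edges) : ∃ q : G.Walk x y,
        q.length < (Walk.cons hxz p).length ∧ q.support ⊆ (Walk.cons hxz p).support := by
      refine ⟨Walk.cons hxc (p.dropUntil c hc), ?_, ?_⟩
      · have hlen := congrArg Walk.length (p.take_spec hc)
        rw [length_append] at hlen
        have : (p.takeUntil c hc).length ≠ 0 := fun h0 => by
          have := eq_of_length_eq_zero h0
          subst this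
          simp at hn
        simp only [length_cons]
        omega
      · rw [support_cons, support_cons]
        exact List.cons_subset_cons _ (p.support_dropUntil_subset_support hc)
    rw [support_cons, List.mem_cons] at ha hb
    rcases ha with rfl | ha
    · exact key b (hb.resolve_left hab.ne') hab he
    rcases hb with rfl | hb
    · exact key a ha hab.symm (by rwa [Sym2.eq_swap])
    obtain ⟨q, hq, hqs⟩ := ih ha hb (fun h => he (by rw [edges_cons]; exact List.mem_cons_of_mem _ h))
    refine ⟨Walk.cons hxz q, by simpa using hq, ?_⟩
    rw [support_cons, support_cons]
    exact List.cons_subset_cons _ hqs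

/-- In a chordal graph two neighbours of `v` that are joined by a walk through
non-neighbours of `v` are adjacent. -/
theorem IsChordalGraph.adj_of_walk (hG : G.IsChordalGraph) {v x y : V} (hx : G.Adj v x)
    (hy : G.Adj v y) (hxy : x ≠ y) (p : G.Walk x y)
    (hp : ∀ u ∈ p.support, u = x ∨ u = y ∨ u ≠ v ∧ ¬ G.Adj v u) : G.Adj x y := by
  classical
  induction hn : p.length using Nat.strong_induction_on generalizing p with
  | _ n ih =>
  by_contra hadj
  have step (q : G.Walk x y) (hq : q.length < n) (hqs : q.support ⊆ p.support) : False :=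
    hadj (ih _ hq q (fun u hu => hp u (hqs hu)) rfl)
  by_cases hpath : p.IsPath
  swap
  · have hlt : p.bypass.length < n := by
      refine lt_of_le_of_ne (hn ▸ p.length_bypass_le_length) fun h => hpath ?_
      rw [← p.bypass_eq_self_of_length_le_length_bypass (by omega)]
      exact p.bypass_isPath
    exact step _ hlt p.support_bypass_subset_support
  have hv : v ∉ p.support := fun h => by
    rcases hp v h with rfl | rfl | h
    exacts [hx.ne rfl, hy.ne rfl, h.1 rfl]
  -- Closing the path through `v` gives a cycle. A chord at `v` would end at a non-neighbour of `v`,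
  -- so any chord joins two vertices of `p` and shortens it.
  have hcyc : (Walk.cons hx (p.concat hy.symm)).IsCycle := by
    rw [Walk.cons_isCycle_iff]
    refine ⟨hpath.concat hv hy.symm, ?_⟩
    rw [Walk.edges_concat, List.concat_eq_append, List.mem_append, List.mem_singleton]
    rintro (h | h)
    · exact hv (p.fst_mem_support_of_mem_edges h)
    · rw [Sym2.eq_swap, Sym2.eq_iff] at h
      rcases h with ⟨h, -⟩ | ⟨-, h⟩
      · exact hxy h
      · exact hy.ne h
  have hlen : 4 ≤ (Walk.cons hx (p.concat hy.symm)).length := by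
    rw [Walk.length_cons, Walk.length_concat]
    have h0 : p.length ≠ 0 := fun h => hxy (Walk.eq_of_length_eq_zero h)
    have h1 : p.length ≠ 1 := fun h => hadj (Walk.adj_of_length_eq_one h)
    omega
  obtain ⟨e, he⟩ := hG v _ hcyc hlen
  induction e with
  | _ a b =>
  rw [Walk.isChord_sym2Mk] at he
  obtain ⟨hab, hnot, ha, hb⟩ := he
  simp only [Walk.edges_cons, Walk.edges_concat, List.concat_eq_append, List.mem_cons,
    List.mem_append, List.not_mem_nil, or_false, not_or, Walk.support_cons,
    Walk.support_concat] at hnot ha hb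
  obtain ⟨hn1, hn2, hn3⟩ := hnot
  have key (c : V) (hvc : G.Adj v c) (hc : c ∈ p.support) (h1 : s(v, c) ≠ s(v, x))
      (h2 : s(v, c) ≠ s(y, v)) : False := by
    rcases hp c hc with rfl | rfl | h
    · exact h1 rfl
    · exact h2 Sym2.eq_swap
    · exact h.2 hvc
  have ha' : a = v ∨ a ∈ p.support := by tauto
  have hb' : b = v ∨ b ∈ p.support := by tauto
  rcases ha' with rfl | ha'
  · exact key b hab (hb'.resolve_left hab.ne') hn1 hn3
  rcases hb' with rfl | hb'
  · exact key a hab.symm ha' (by rwa [Sym2.eq_swap]) (by rwa [Sym2.eq_swap])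
  obtain ⟨q, hq, hqs⟩ := p.exists_shorter_of_adj ha' hb' hab hn2
  exact step q (hn ▸ hq) hqs

/-- Dirac's theorem, relative to a set `U` of vertices: a vertex that is not adjacent to all the
others has a non-neighbour whose neighbourhood in `U` is complete. -/
theorem IsChordalGraph.exists_simplicial_not_adj (hG : G.IsChordalGraph) (U : Finset V) {v : V}
    (hv : v ∈ U) (hw : ∃ w ∈ U, w ≠ v ∧ ¬ G.Adj v w) :
    ∃ z ∈ U, z ≠ v ∧ ¬ G.Adj v z ∧ G.IsClique {u | u ∈ U ∧ G.Adj z u} := by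
  classical
  induction hn : U.card using Nat.strong_induction_on generalizing U v with
  | _ n ih =>
  obtain ⟨w, hwU, hwv, hvw⟩ := hw
  -- `K` is the component of `w` among the non-neighbours of `v` in `U`, and `S` is its boundary in
  -- `U`. Vertices of `S` are neighbours of `v` joined through `K`, so `S` is complete.
  let W := U.filter fun u => u ≠ v ∧ ¬ G.Adj v u
  have hW (u : V) : u ∈ W ↔ u ∈ U ∧ u ≠ v ∧ ¬ G.Adj v u := by simp [W]
  let K := W.filter fun u => ∃ p : G.Walk w u, ∀ t ∈ p.support, t ∈ W
  have hK (u : V) : u ∈ K ↔ u ∈ W ∧ ∃ p : G.Walk w u, ∀ t ∈ p.support, t ∈ W := by simp [K]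
  have hwW : w ∈ W := (hW w).2 ⟨hwU, hwv, hvw⟩
  have hwK : w ∈ K := (hK w).2 ⟨hwW, Walk.nil, by simpa using hwW⟩
  have hKadj (k u : V) (hk : k ∈ K) (hu : u ∈ W) (hku : G.Adj k u) : u ∈ K := by
    obtain ⟨-, p, hp⟩ := (hK k).1 hk
    refine (hK u).2 ⟨hu, p.concat hku, fun t ht => ?_⟩
    rw [Walk.support_concat, List.mem_append, List.mem_singleton] at ht
    rcases ht with ht | rfl
    exacts [hp t ht, hu]
  let S := U.filter fun u => u ∉ K ∧ ∃ k ∈ K, G.Adj k u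
  have hS (u : V) : u ∈ S ↔ u ∈ U ∧ u ∉ K ∧ ∃ k ∈ K, G.Adj k u := by simp [S]
  have hSv (u : V) (hu : u ∈ S) : G.Adj v u := by
    obtain ⟨huU, huK, k, hk, hku⟩ := (hS u).1 hu
    by_contra hvu
    refine huK (hKadj k u hk ((hW u).2 ⟨huU, ?_, hvu⟩) hku)
    rintro rfl
    exact ((hW k).1 ((hK k).1 hk).1).2.2 hku.symm
  have hSclique (x y : V) (hx : x ∈ S) (hy : y ∈ S) (hxy : x ≠ y) : G.Adj x y := by
    obtain ⟨-, -, k, hk, hkx⟩ := (hS x).1 hx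
    obtain ⟨-, -, l, hl, hly⟩ := (hS y).1 hy
    obtain ⟨-, p, hp⟩ := (hK k).1 hk
    obtain ⟨-, q, hq⟩ := (hK l).1 hl
    refine hG.adj_of_walk (hSv x hx) (hSv y hy) hxy
      (Walk.cons hkx.symm ((p.reverse.append q).concat hly)) fun u hu => ?_
    simp only [Walk.support_cons, Walk.support_concat, List.mem_cons, List.mem_append, List.not_mem_nil, or_false, Walk.mem_support_append_iff,
      Walk.support_reverse, List.mem_reverse] at hu
    rcases hu with rfl | (hu | hu) | rfl
    · exact Or.inl rfl
    · exact Or.inr (Or.inr ((hW u).1 (hp u hu)).2)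
    · exact Or.inr (Or.inr ((hW u).1 (hq u hu)).2)
    · exact Or.inr (Or.inl rfl)
  have hKU (u : V) (hu : u ∈ K) : u ∈ U := ((hW u).1 ((hK u).1 hu).1).1
  have hsub : K ∪ S ⊆ U := fun u hu =>
    (Finset.mem_union.1 hu).elim (hKU u) fun h => ((hS u).1 h).1
  have hvnot : v ∉ K ∪ S := fun h => (Finset.mem_union.1 h).elim
    (fun h => ((hW v).1 ((hK v).1 h).1).2.1 rfl) (fun h => (hSv v h).ne rfl)
  have hcard : (K ∪ S).card < n := hn ▸ Finset.card_lt_card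
    ((Finset.ssubset_iff_of_subset hsub).2 ⟨v, hv, hvnot⟩)
  -- All neighbours in `U` of a vertex of `K` lie in `K ∪ S`, which omits `v`, so induction applies
  -- there.
  suffices h : ∃ z ∈ K, G.IsClique {u | u ∈ K ∪ S ∧ G.Adj z u} by
    obtain ⟨z, hz, hcl⟩ := h
    have hz' := (hW z).1 ((hK z).1 hz).1
    have hmem (u : V) (hu : u ∈ U ∧ G.Adj z u) : u ∈ K ∪ S ∧ G.Adj z u := by
      refine ⟨?_, hu.2⟩
      by_cases huK : u ∈ K
      · exact Finset.mem_union_left _ huK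
      · exact Finset.mem_union_right _ ((hS u).2 ⟨hu.1, huK, z, hz, hu.2⟩)
    exact ⟨z, hz'.1, hz'.2.1, hz'.2.2, fun a ha b hb => hcl (hmem a ha) (hmem b hb)⟩
  -- Prescribing a non-neighbour keeps the simplicial vertex out of `S`: a vertex not adjacent to `s
  -- ∈ S` is not in the complete set `S`. If instead `S` is joined to everything, a vertex not
  -- adjacent to some `k ∈ K` is not in `S`. Otherwise `K ∪ S` is complete and `w` works.
  by_cases h1 : ∃ s ∈ S, ∃ t ∈ K ∪ S, t ≠ s ∧ ¬ G.Adj s t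
  · obtain ⟨s, hs, hst⟩ := h1
    obtain ⟨z, hz, hzs, hsz, hcl⟩ := ih _ hcard (K ∪ S) (Finset.mem_union_right _ hs) hst rfl
    exact ⟨z, (Finset.mem_union.1 hz).resolve_right fun h => hsz (hSclique s z hs h hzs.symm), hcl⟩
  push Not at h1
  by_cases h2 : ∃ k ∈ K, ∃ t ∈ K ∪ S, t ≠ k ∧ ¬ G.Adj k t
  · obtain ⟨k, hk, hkt⟩ := h2
    obtain ⟨z, hz, hzk, hkz, hcl⟩ := ih _ hcard (K ∪ S) (Finset.mem_union_left _ hk) hkt rfl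
    exact ⟨z, (Finset.mem_union.1 hz).resolve_right fun h =>
      hkz (h1 z h k (Finset.mem_union_left _ hk) hzk.symm).symm, hcl⟩
  push Not at h2
  refine ⟨w, hwK, fun s hs t ht hst => ?_⟩
  rcases Finset.mem_union.1 hs.1 with h | h
  · exact h2 s h t ht.1 hst.symm
  · exact h1 s h t ht.1 hst.symm

theorem IsChordalGraph.exists_simplicial (hG : G.IsChordalGraph) {U : Finset V}
    (hU : U.Nonempty) : ∃ z ∈ U, G.IsClique {u | u ∈ U ∧ G.Adj z u} := by
  by_cases h : ∃ v ∈ U, ∃ w ∈ U, w ≠ v ∧ ¬ G.Adj v w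
  · obtain ⟨v, hv, hw⟩ := h
    obtain ⟨z, hz, -, -, hcl⟩ := hG.exists_simplicial_not_adj U hv hw
    exact ⟨z, hz, hcl⟩
  · push Not at h
    obtain ⟨z, hz⟩ := hU
    exact ⟨z, hz, fun s hs t ht hst => h s hs.1 t ht.1 hst.symm⟩

end Chordal

end SimpleGraph

namespace SimpleGraph

/-! ### Existence of a junction tree -/

section ExistsJunctionTree

variable {V : Type*} {G : SimpleGraph V}

/-- Attaching a new vertex `none` to the vertex `i` of a graph. -/
def addLeaf {I : Type*} (T : SimpleGraph I) (i : I) : SimpleGraph (Option I) :=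
  T.map Function.Embedding.some ⊔ edge none (some i)

/-- The inclusion of a graph into its extension by a leaf. -/
def addLeafHom {I : Type*} (T : SimpleGraph I) (i : I) : T →g T.addLeaf i where
  toFun := some
  map_rel' h := Or.inl ((Embedding.map Function.Embedding.some T).map_adj_iff.2 h)

theorem addLeaf_adj {I : Type*} (T : SimpleGraph I) (i : I) :
    (T.addLeaf i).Adj none (some i) :=
  Or.inr ((edge_adj _ _ _ _).2 ⟨Or.inl ⟨rfl, rfl⟩, by simp⟩)

theorem IsTree.addLeaf {I : Type*} [Finite I] {T : SimpleGraph I} (hT : T.IsTree) (i : I) :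
    (T.addLeaf i).IsTree := by
  classical
  have := Fintype.ofFinite I
  rw [isTree_iff_connected_and_card]
  constructor
  · have h (j : Option I) : (T.addLeaf i).Reachable j (some i) := by
      cases j with
      | none => exact (T.addLeaf_adj i).reachable
      | some j => exact (hT.connected.preconnected j i).map (T.addLeafHom i)
    exact ⟨fun j k => (h j).trans (h k).symm⟩
  · have hnot : ¬ (T.map Function.Embedding.some).Adj none (some i) := by
      rw [map_adj]
      rintro ⟨a, b, -, ha, -⟩
      cases ha
    have h1 := card_edgeFinset_sup_edge (T.map Function.Embedding.some) hnot (by simp)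
    have h2 := card_edgeFinset_map Function.Embedding.some T
    have h3 := hT.card_edgeFinset
    have h4 : Nat.card (T.addLeaf i).edgeSet =
        (T.map Function.Embedding.some ⊔ edge none (some i)).edgeFinset.card := by
      rw [edgeFinset_card, ← Nat.card_eq_fintype_card]
      rfl
    rw [h4, h1, h2, h3, Nat.card_eq_fintype_card, Fintype.card_option]

variable [DecidableEq V]

/-- The maximal complete subsets of `U` when `z ∈ U` has a complete neighbourhood `N` in `U`. -/
theorem maximal_isClique_iff_of_simplicial {U N : Finset V} {z : V} (hz : z ∈ U)
    (hN : ∀ u, u ∈ N ↔ u ∈ U ∧ G.Adj z u) (hcl : G.IsClique (N : Set V)) (C : Finset V) :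
    Maximal (fun s : Finset V => s ⊆ U ∧ G.IsClique (s : Set V)) C ↔
      C = insert z N ∨
        C ≠ N ∧ Maximal (fun s : Finset V => s ⊆ U.erase z ∧ G.IsClique (s : Set V)) C := by
  have hzN : z ∉ N := fun h => ((hN z).1 h).2.ne rfl
  have hZU : insert z N ⊆ U := Finset.insert_subset hz fun u hu => ((hN u).1 hu).1
  have hZcl : G.IsClique ((insert z N : Finset V) : Set V) := by
    rw [Finset.coe_insert]
    exact hcl.insert fun u hu _ => ((hN u).1 hu).2
  have hle (s : Finset V) (hs : s ⊆ U) (hc : G.IsClique (s : Set V)) (hzs : z ∈ s) :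
      s ⊆ insert z N := fun u hu => by
    by_cases huz : u = z
    · exact huz ▸ Finset.mem_insert_self _ _
    · exact Finset.mem_insert_of_mem ((hN u).2 ⟨hs hu, hc hzs hu (Ne.symm huz)⟩)
  constructor
  · intro hC
    by_cases hzC : z ∈ C
    · exact Or.inl (hC.eq_of_le ⟨hZU, hZcl⟩ (hle C hC.prop.1 hC.prop.2 hzC))
    · refine Or.inr ⟨?_, ⟨⟨Finset.subset_erase.2 ⟨hC.prop.1, hzC⟩, hC.prop.2⟩, ?_⟩⟩
      · rintro rfl
        exact hzC (hC.le_of_ge ⟨hZU, hZcl⟩ (Finset.subset_insert _ _) (Finset.mem_insert_self _ _))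
      · exact fun s hs hCs => hC.le_of_ge ⟨hs.1.trans (Finset.erase_subset _ _), hs.2⟩ hCs
  · rintro (rfl | ⟨hCN, hC⟩)
    · exact ⟨⟨hZU, hZcl⟩, fun s hs hZs => hle s hs.1 hs.2 (hZs (Finset.mem_insert_self _ _))⟩
    · refine ⟨⟨hC.prop.1.trans (Finset.erase_subset _ _), hC.prop.2⟩, fun s hs hCs => ?_⟩
      by_cases hzs : z ∈ s
      · refine absurd (hC.eq_of_le (y := N) ⟨?_, hcl⟩ ?_) hCN
        · exact Finset.subset_erase.2 ⟨fun u hu => ((hN u).1 hu).1, hzN⟩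
        · exact (Finset.subset_insert_iff_of_notMem fun h =>
            (Finset.mem_erase.1 (hC.prop.1 h)).1 rfl).1 (hCs.trans (hle s hs.1 hs.2 hzs))
      · exact hC.le_of_ge ⟨Finset.subset_erase.2 ⟨hs.1, hzs⟩, hs.2⟩ hCs

/-- The maximal complete subsets of a set `U` of vertices of a chordal graph are the nodes of a
tree in which the nodes containing any given vertex are connected. -/
theorem IsChordalGraph.exists_tree (hG : G.IsChordalGraph) (U : Finset V) :
    ∃ (I : Type) (_ : Finite I) (T : SimpleGraph I) (X : I → Finset V), T.IsTree ∧
      X.Injective ∧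
      (∀ C, (∃ i, X i = C) ↔
        Maximal (fun s : Finset V => s ⊆ U ∧ G.IsClique (s : Set V)) C) ∧
      ∀ v i j, v ∈ X i → v ∈ X j → ∃ p : T.Walk i j, ∀ k ∈ p.support, v ∈ X k := by
  classical
  induction hn : U.card using Nat.strong_induction_on generalizing U with
  | _ n ih =>
  rcases U.eq_empty_or_nonempty with rfl | hU
  -- The empty set is the one maximal complete subset, so the tree has one node, not none.
  · refine ⟨Unit, inferInstance, ⊥, fun _ => ∅, IsTree.of_subsingleton,
      Function.injective_of_subsingleton _, fun C => ⟨?_, fun hC => ⟨(), ?_⟩⟩, by simp⟩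
    · rintro ⟨-, rfl⟩
      exact ⟨⟨subset_rfl, by simp⟩, fun s hs _ => hs.1⟩
    · exact (Finset.subset_empty.1 hC.prop.1).symm
  obtain ⟨z, hz, hzcl⟩ := hG.exists_simplicial hU
  let N := U.filter fun u => G.Adj z u
  have hN (u : V) : u ∈ N ↔ u ∈ U ∧ G.Adj z u := by simp [N]
  have hcl : G.IsClique (N : Set V) := fun a ha b hb => hzcl ((hN a).1 ha) ((hN b).1 hb)
  have hzN : z ∉ N := fun h => ((hN z).1 h).2.ne rfl
  have hNU : N ⊆ U.erase z := fun u hu =>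
    Finset.mem_erase.2 ⟨fun h => hzN (h ▸ hu), ((hN u).1 hu).1⟩
  obtain ⟨I, _, T, X, hT, hinj, hX, hwalk⟩ := ih _
    (hn ▸ Finset.card_erase_lt_of_mem hz) (U.erase z) rfl
  have hzX (i : I) : z ∉ X i := fun h =>
    (Finset.mem_erase.1 (((hX _).1 ⟨i, rfl⟩).prop.1 h)).1 rfl
  have hZX (i : I) : insert z N ≠ X i := fun h => hzX i (h ▸ Finset.mem_insert_self _ _)
  simp only [maximal_isClique_iff_of_simplicial hz hN hcl, ← hX]
  -- Restoring the simplicial vertex `z` creates the clique `insert z N`. If `N` was a node, this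
  -- clique replaces it; otherwise it becomes a new leaf attached to a node containing `N`.
  by_cases hNX : ∃ i, X i = N
  · obtain ⟨i₀, hi₀⟩ := hNX
    have hself : Function.update X i₀ (insert z N) i₀ = insert z N := Function.update_self ..
    have hne (i : I) (hi : i ≠ i₀) : Function.update X i₀ (insert z N) i = X i :=
      Function.update_of_ne hi ..
    have hmem (v : V) (hv : v ≠ z) (i : I) :
        v ∈ Function.update X i₀ (insert z N) i ↔ v ∈ X i := by
      by_cases hi : i = i₀
      · rw [hi, hself, hi₀, Finset.mem_insert, or_iff_right hv]
      · rw [hne i hi]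
    have hz₀ (i : I) (hi : z ∈ Function.update X i₀ (insert z N) i) : i = i₀ := by
      by_contra h
      rw [hne i h] at hi
      exact hzX i hi
    refine ⟨I, inferInstance, T, Function.update X i₀ (insert z N), hT, ?_, fun C => ?_, ?_⟩
    · intro i j hij
      by_cases hi : i = i₀ <;> by_cases hj : j = i₀
      · rw [hi, hj]
      · rw [hi, hself, hne j hj] at hij
        exact absurd hij (hZX j)
      · rw [hj, hself, hne i hi] at hij
        exact absurd hij.symm (hZX i)
      · rw [hne i hi, hne j hj] at hij
        exact hinj hij
    · constructor
      · rintro ⟨i, rfl⟩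
        by_cases hi : i = i₀
        · exact Or.inl (by rw [hi, hself])
        · rw [hne i hi]
          exact Or.inr ⟨fun h => hi (hinj (h.trans hi₀.symm)), i, rfl⟩
      · rintro (rfl | ⟨hCN, i, rfl⟩)
        · exact ⟨i₀, hself⟩
        · exact ⟨i, hne i fun h => hCN (h ▸ hi₀)⟩
    · intro v i j hvi hvj
      by_cases hv : v = z
      · rw [hv] at hvi hvj
        obtain rfl := (hz₀ i hvi).trans (hz₀ j hvj).symm
        exact ⟨Walk.nil, by simpa [hv] using hvi⟩
      · obtain ⟨p, hp⟩ := hwalk v i j ((hmem v hv i).1 hvi) ((hmem v hv j).1 hvj)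
        exact ⟨p, fun k hk => (hmem v hv k).2 (hp k hk)⟩
  · have hNmax : ∃ i, N ⊆ X i := by
      have hfin : {s : Finset V | s ⊆ U.erase z ∧ G.IsClique (s : Set V)}.Finite :=
        (Finset.finite_toSet (U.erase z).powerset).subset fun s hs =>
          Finset.mem_coe.2 (Finset.mem_powerset.2 hs.1)
      obtain ⟨C, hNC, hC⟩ := hfin.exists_le_maximal (a := N) ⟨hNU, hcl⟩
      obtain ⟨i, hi⟩ := (hX C).2 hC
      exact ⟨i, hi ▸ hNC⟩
    obtain ⟨i₀, hi₀⟩ := hNmax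
    refine ⟨Option I, inferInstance, T.addLeaf i₀, fun i => i.elim (insert z N) X,
      hT.addLeaf i₀, ?_, fun C => ?_, ?_⟩
    · rintro (_ | i) (_ | j) hij
      · rfl
      · exact absurd hij (hZX j)
      · exact absurd hij.symm (hZX i)
      · exact congrArg some (hinj hij)
    · constructor
      · rintro ⟨_ | i, rfl⟩
        · exact Or.inl rfl
        · exact Or.inr ⟨fun h => hNX ⟨i, h⟩, i, rfl⟩
      · rintro (rfl | ⟨-, i, rfl⟩)
        exacts [⟨none, rfl⟩, ⟨some i, rfl⟩]
    · intro v
      have hsome (i j : I) (hi : v ∈ X i) (hj : v ∈ X j) :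
          ∃ p : (T.addLeaf i₀).Walk (some i) (some j),
            ∀ k ∈ p.support, v ∈ Option.elim k (insert z N) X := by
        obtain ⟨p, hp⟩ := hwalk v i j hi hj
        refine ⟨p.map (T.addLeafHom i₀), fun k hk => ?_⟩
        obtain ⟨l, hl, rfl⟩ := List.mem_map.1 (Walk.support_map (T.addLeafHom i₀) p ▸ hk)
        exact hp l hl
      have hnone (j : I) (h : v ∈ insert z N) (hj : v ∈ X j) :
          ∃ p : (T.addLeaf i₀).Walk none (some j),
            ∀ k ∈ p.support, v ∈ Option.elim k (insert z N) X := by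
        have hvN : v ∈ N := (Finset.mem_insert.1 h).resolve_left fun hvz => hzX j (hvz ▸ hj)
        obtain ⟨p, hp⟩ := hsome i₀ j (hi₀ hvN) hj
        refine ⟨Walk.cons (T.addLeaf_adj i₀) p, fun k hk => ?_⟩
        rw [Walk.support_cons, List.mem_cons] at hk
        rcases hk with rfl | hk
        exacts [h, hp k hk]
      rintro (_ | i) (_ | j) hi hj
      · exact ⟨Walk.nil, by simpa using hi⟩
      · exact hnone j hi hj
      · obtain ⟨p, hp⟩ := hnone i hj hi
        exact ⟨p.reverse, fun k hk => hp k (by simpa using hk)⟩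
      · exact hsome i j hi hj

theorem IsChordalGraph.exists_isJunctionTree [Fintype V] (hG : G.IsChordalGraph) :
    ∃ T : SimpleGraph G.maxCliques, IsJunctionTree T := by
  classical
  obtain ⟨I, _, T, X, hT, hinj, hX, hwalk⟩ := hG.exists_tree Finset.univ
  simp only [Finset.subset_univ, true_and] at hX
  have hmem (C : Finset V) : C ∈ G.maxCliques ↔ ∃ i, X i = C := by
    rw [hX, maxCliques, Finset.mem_filter, and_iff_right (Finset.mem_univ _)]
  let f : I → G.maxCliques := fun i => ⟨X i, (hmem _).2 ⟨i, rfl⟩⟩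
  have hf : f.Bijective := ⟨fun i j hij => hinj (congrArg Subtype.val hij), fun C => by
    obtain ⟨i, hi⟩ := (hmem C).1 C.2
    exact ⟨i, Subtype.ext hi⟩⟩
  let e : I ≃ G.maxCliques := Equiv.ofBijective f hf
  let φ : T.comap e.symm ≃g T := Iso.comap e.symm T
  have hT' : (T.comap e.symm).IsTree := φ.isTree_iff.2 hT
  refine ⟨T.comap e.symm, hT', fun C₁ C₂ p hp C hC v hv => ?_⟩
  have hXe (D : G.maxCliques) : X (e.symm D) = D := congrArg Subtype.val (e.apply_symm_apply D)
  rw [Finset.mem_inter] at hv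
  obtain ⟨q, hq⟩ := hwalk v (e.symm C₁) (e.symm C₂) (by rw [hXe]; exact hv.1)
    (by rw [hXe]; exact hv.2)
  -- Paths in a tree are unique, so the given path runs inside a walk all of whose nodes contain
  -- `v`.
  have hpq : p.map φ.toHom = q.bypass := (hT.existsUnique_path _ _).unique
    (hp.map φ.injective) q.bypass_isPath
  have hC₁ : φ.toHom C ∈ (p.map φ.toHom).support := by
    rw [Walk.support_map]
    exact List.mem_map_of_mem hC
  have hC' : e.symm C ∈ q.support := q.support_bypass_subset_support (hpq ▸ hC₁)
  rw [← hXe]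
  exact hq _ hC'

end ExistsJunctionTree

end SimpleGraph

/-! ### Separations and splits of the cliques -/

namespace SimpleGraph

variable {V : Type*} [Fintype V] {G : SimpleGraph V}

theorem exists_mem_maxCliques {s : Finset V} (hs : G.IsClique (s : Set V)) :
    ∃ C : G.maxCliques, s ⊆ C := by
  classical
  obtain ⟨C, hC, hmax⟩ := (Set.toFinite {s : Finset V | G.IsClique (s : Set V)}).exists_le_maximal hs
  exact ⟨⟨C, by simpa [maxCliques] using hmax⟩, hC⟩

theorem isClique_of_mem_maxCliques (C : G.maxCliques) : G.IsClique ((C : Finset V) : Set V) := by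
  classical
  exact (Finset.mem_filter.1 C.2).2.prop

variable [DecidableEq V]

theorem biUnion_maxCliques :
    Finset.univ.biUnion (fun C : G.maxCliques => (C : Finset V)) = Finset.univ := by
  ext v
  obtain ⟨C, hC⟩ := exists_mem_maxCliques (G := G) (s := {v}) (by simp)
  simp only [Finset.mem_biUnion, Finset.mem_univ, true_and, iff_true]
  exact ⟨C, hC (Finset.mem_singleton_self v)⟩

/-- Grouping edges by their intersection; the induction over the tree needs the sum over edges. -/
theorem sum_separators (T : SimpleGraph G.maxCliques) [Fintype T.edgeSet] (h : Finset V → ℝ) :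
    ∑ D ∈ separators T, (separatorMult T D : ℝ) * h D = ∑ e ∈ T.edgeFinset, h (edgeInter e) := by
  classical
  rw [Finset.sum_comp]
  unfold separators separatorMult
  simp only [nsmul_eq_mul]
  congr!

/-- A split of the vertices into two sets covering all cliques separates the two sides. -/
theorem separates_of_cover {S T : Finset V}
    (hC : ∀ C : G.maxCliques, (C : Finset V) ⊆ S ∨ (C : Finset V) ⊆ T) :
    G.Separates (S \ T) (T \ S) (S ∩ T) := by
  have key {a b : V} (p : G.Walk a b) (ha : a ∈ S \ T) (hb : b ∈ T \ S) :
      ∃ v ∈ p.support, v ∈ S ∩ T := by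
    induction p with
    | nil => exact absurd (Finset.mem_sdiff.1 hb).1 (Finset.mem_sdiff.1 ha).2
    | @cons u w b huw p ih =>
      rw [Finset.mem_sdiff] at ha
      -- Each edge lies in a clique, hence in `S` or in `T`, so no step jumps from `S \ T` to `T \
      -- S`.
      obtain ⟨C, huC⟩ := exists_mem_maxCliques (G := G) (s := {u, w}) (by
        rw [Finset.coe_pair]
        exact isClique_pair.2 fun _ => huw)
      have hCS : (C : Finset V) ⊆ S := (hC C).resolve_right fun h =>
        ha.2 (h (huC (Finset.mem_insert_self _ _)))
      have hwS : w ∈ S := hCS (huC (by simp))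
      by_cases hwT : w ∈ T
      · exact ⟨w, by simp, Finset.mem_inter.2 ⟨hwS, hwT⟩⟩
      · obtain ⟨v, hv, hvD⟩ := ih (Finset.mem_sdiff.2 ⟨hwS, hwT⟩) hb
        exact ⟨v, by rw [Walk.support_cons]; exact List.mem_cons_of_mem _ hv, hvD⟩
  exact fun a ha b hb p _ => key p ha hb

/-- A separation extends to a split of all the vertices that covers all cliques. -/
theorem Separates.exists_cover {A B D : Finset V} (hAD : Disjoint A D)
    (h : G.Separates A B D) :
    ∃ S T : Finset V, S ∪ T = Finset.univ ∧ S ∩ T = D ∧ A ⊆ S ∧ B ⊆ T ∧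
      ∀ C : G.maxCliques, (C : Finset V) ⊆ S ∨ (C : Finset V) ⊆ T := by
  classical
  -- `R` is the set of vertices reachable from `A` while avoiding `D`; the split is `R ∪ D` and
  -- `Rᶜ`. A clique that meets `R` cannot leave `R ∪ D`.
  let R : Finset V := Finset.univ.filter fun u => ∃ a ∈ A, ∃ p : G.Walk a u, ∀ t ∈ p.support, t ∉ D
  have hR (u : V) : u ∈ R ↔ ∃ a ∈ A, ∃ p : G.Walk a u, ∀ t ∈ p.support, t ∉ D := by simp [R]
  have hRD (u : V) (hu : u ∈ R) : u ∉ D := by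
    obtain ⟨a, -, p, hp⟩ := (hR u).1 hu
    exact hp u p.end_mem_support
  refine ⟨R ∪ D, Rᶜ, ?_, ?_, ?_, ?_, ?_⟩
  · ext v
    by_cases hv : v ∈ R <;> simp [hv]
  · ext v
    have := hRD v
    simp only [Finset.mem_inter, Finset.mem_union, Finset.mem_compl]
    tauto
  · intro a ha
    refine Finset.mem_union_left _ ((hR a).2 ⟨a, ha, Walk.nil, ?_⟩)
    simpa using Finset.disjoint_left.1 hAD ha
  · intro b hb
    rw [Finset.mem_compl, hR]
    rintro ⟨a, ha, p, hp⟩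
    obtain ⟨v, hv, hvD⟩ := h a ha b hb p.bypass p.bypass_isPath
    exact hp v (p.support_bypass_subset_support hv) hvD
  · intro C
    by_cases hCR : ∃ u ∈ (C : Finset V), u ∈ R
    · obtain ⟨u, huC, hu⟩ := hCR
      refine Or.inl fun w hw => ?_
      by_cases hwD : w ∈ D
      · exact Finset.mem_union_right _ hwD
      by_cases huw : u = w
      · exact Finset.mem_union_left _ (huw ▸ hu)
      obtain ⟨a, ha, p, hp⟩ := (hR u).1 hu
      refine Finset.mem_union_left _ ((hR w).2
        ⟨a, ha, p.concat (isClique_of_mem_maxCliques C huC hw huw), fun t ht => ?_⟩)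
      rw [Walk.support_concat, List.mem_append, List.mem_singleton] at ht
      rcases ht with ht | rfl
      exacts [hp t ht, hwD]
    · exact Or.inr fun w hw => Finset.mem_compl.2 fun h => hCR ⟨w, hw, h⟩

end SimpleGraph

/-! ### The Markov property as modularity, and the conclusion -/

namespace QState

variable {V : Type*} [Fintype V] [DecidableEq V] {ι : V → Type*} [∀ v, Fintype (ι v)]

/-- Trace one excludes zero-dimensional sites, over which a partial trace would vanish and not be
positive definite. -/
theorem nonempty_of_isPosDensity {ρ : Matrix (∀ v, ι v) (∀ v, ι v) ℂ} (hρ : IsPosDensity ρ)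
    (v : V) : Nonempty (ι v) := by
  by_contra h
  have := not_nonempty_iff.1 h
  have : IsEmpty (∀ v, ι v) := ⟨fun x => isEmptyElim (x v)⟩
  have h1 := hρ.trace_eq_one
  rw [Matrix.trace_eq_zero_of_isEmpty] at h1
  exact zero_ne_one h1

variable [∀ v, DecidableEq (ι v)]

/-- The quantum Markov property says that the entropy is modular on the splits of the vertices
that cover all cliques. -/
theorem isQuantumMarkov_iff {G : SimpleGraph V} {ρ : Matrix (∀ v, ι v) (∀ v, ι v) ℂ}
    (hρ : IsPosDensity ρ) :
    IsQuantumMarkov G ρ ↔ ∀ S T : Finset V, S ∪ T = Finset.univ →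
      (∀ C : G.maxCliques, (C : Finset V) ⊆ S ∨ (C : Finset V) ⊆ T) →
      entropy (marginal ρ S) + entropy (marginal ρ T) =
        entropy (marginal ρ (S ∩ T)) + entropy (marginal ρ (S ∪ T)) := by
  have := nonempty_of_isPosDensity hρ
  constructor
  · intro hM S T hST hC
    have h := hM (S \ T) (T \ S) (S ∩ T) disjoint_sdiff_sdiff
      (Finset.disjoint_left.2 (by simp; tauto)) (Finset.disjoint_left.2 (by simp; tauto))
      (SimpleGraph.separates_of_cover hC)
    have e1 : S \ T ∪ S ∩ T = S := Finset.sdiff_union_inter S T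
    have e2 : T \ S ∪ S ∩ T = T := by rw [Finset.inter_comm, Finset.sdiff_union_inter]
    have e3 : S \ T ∪ T \ S ∪ S ∩ T = S ∪ T := by
      ext v
      simp only [Finset.mem_union, Finset.mem_inter, Finset.mem_sdiff]
      tauto
    rw [CondIndep, condMutualInfo, e1, e2, e3] at h
    linarith
  · intro hM A B D hAB hAD _ hsep
    obtain ⟨S, T, hST, hD, hAS, hBT, hC⟩ := hsep.exists_cover hAD
    have hinter : (A ∪ D) ∩ (B ∪ D) = D := by
      rw [← Finset.inter_union_distrib_right, Finset.disjoint_iff_inter_eq_empty.1 hAB,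
        Finset.empty_union]
    have hunion : A ∪ D ∪ (B ∪ D) = A ∪ B ∪ D := (Finset.union_union_distrib_right A B D).symm
    have h := SimpleGraph.modular_of_subset (h := fun A => entropy (marginal ρ A))
      (entropy_marginal_submodular hρ.posDef) (S := S) (T := T) (S₁ := A ∪ D) (T₁ := B ∪ D)
      (Finset.union_subset hAS (hD ▸ Finset.inter_subset_left))
      (Finset.union_subset hBT (hD ▸ Finset.inter_subset_right)) (hinter.trans hD.symm)
      (hM S T hST hC)
    rw [hinter, hunion] at h
    rw [CondIndep, condMutualInfo]
    linarith

end QState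

theorem mainTheorem7 {V : Type*} [Fintype V] [DecidableEq V]
    (ι : V → Type*) [∀ v, Fintype (ι v)] [∀ v, DecidableEq (ι v)]
    (G : SimpleGraph V) (hG : G.IsChordalGraph) :
    (∃ T : SimpleGraph G.maxCliques, SimpleGraph.IsJunctionTree T) ∧
    ∀ T : SimpleGraph G.maxCliques, SimpleGraph.IsJunctionTree T →
      ∀ ρ : Matrix (∀ v, ι v) (∀ v, ι v) ℂ, QState.IsPosDensity ρ →
        QState.entropy ρ ≤
          ∑ C ∈ G.maxCliques, QState.entropy (QState.marginal ρ C)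
            - ∑ D ∈ SimpleGraph.separators T,
                (SimpleGraph.separatorMult T D : ℝ) * QState.entropy (QState.marginal ρ D) ∧
        (QState.entropy ρ =
          ∑ C ∈ G.maxCliques, QState.entropy (QState.marginal ρ C)
            - ∑ D ∈ SimpleGraph.separators T,
                (SimpleGraph.separatorMult T D : ℝ) * QState.entropy (QState.marginal ρ D) ↔
          QState.IsQuantumMarkov G ρ) := by
  classical
  refine ⟨hG.exists_isJunctionTree, fun T hT ρ hρ => ?_⟩
  have := QState.nonempty_of_isPosDensity hρ
  have key := SimpleGraph.submodular_le_junctionTree_sum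
    (h := fun A => QState.entropy (QState.marginal ρ A))
    (QState.entropy_marginal_submodular hρ.posDef) hT.isTree
    (fun C : G.maxCliques => (C : Finset V)) hT.inter_subset
  rw [SimpleGraph.biUnion_maxCliques, QState.entropy_marginal_univ hρ.posDef.1] at key
  rw [SimpleGraph.sum_separators T fun A => QState.entropy (QState.marginal ρ A),
    QState.isQuantumMarkov_iff hρ,
    ← Finset.sum_coe_sort G.maxCliques fun A => QState.entropy (QState.marginal ρ A)]
  -- `interEdge` for the family of cliques unfolds to `edgeInter`.
  exact key
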